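/- Let $G=(V,E,w)$ be a finite undirected weighted graph with $N=|V|$ vertices, without self-loops and without isolated vertices, with symmetric weights $w_{uv}>0$ on the edges and $w_{uv}=0$ otherwise. Write $d_u=\sum_v w_{uv}$, $\mathrm{vol}(S)=\sum_{u\in S}d_u$ and $|E(S,T)|=\sum_{u\in S,\,v\in T}w_{uv}$. Let $\lambda_1\le\lambda_2\le\dots\le\lambda_N$ be the eigenvalues, counted with multiplicity, of the normalized Laplacian $$\Delta f(u)=\frac1{d_u}\sum_{v}w_{uv}\,(f(u)-f(v))$$ on the Hilbert space of real functions on $V$ with inner product $(f,g)=\sum_u d_u f(u)g(u)$; they lie in $[0,2]$. For $1\le k\le N$ let $$\overline h(k)=\max\ \min_{1\le i\le k}\ \frac{2\,|E(V_{2i-1},V_{2i})|}{\mathrm{vol}(V_{2i-1}\cup V_{2i})},$$ where the maximum is over all $k$-tuples of pairs $(V_1,V_2),\dots,(V_{2k-1},V_{2k})$ of subsets of $V$ such that $V_1,\dots,V_{2k}$ are pairwise disjoint and $V_{2i-1}\cup V_{2i}\ne\emptyset$ for every $i$. **Theorem (improved higher-order dual Cheeger inequality).** There is a universal constant $C>0$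 such that for every such graph $G$ and all integers $1\le k\le l\le N$, $$1-\overline h(k)\ \le\ C\,l\,k^6\,\frac{2-\lambda_{N-k+1}}{\sqrt{2-\lambda_{N-l+1}}}.$$ Here, if $2-\lambda_{N-l+1}=0$ (so that also $2-\lambda_{N-k+1}=0$), the quotient $0/0$ is read as $0$, and the inequality then says $\overline h(k)=1$. -/

import Mathlib

/-- An undirected weighted graph without self-loops: a simple graph with positive symmetric edge
weights, put equal to `0` off the edges. There are no isolated vertices, so that every degree is
positive (the normalized Laplacian divides by the degrees). -/
structure WeightedGraph (V : Type*) extends SimpleGraph V where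
  w : V → V → ℝ
  w_symm : ∀ u v, w u v = w v u
  w_pos : ∀ u v, Adj u v → 0 < w u v
  w_eq_zero : ∀ u v, ¬ Adj u v → w u v = 0
  exists_adj : ∀ u, ∃ v, Adj u v

namespace WeightedGraph

noncomputable section

section Spectrum

variable {V : Type*} [Fintype V] (G : WeightedGraph V)

theorem w_nonneg {V : Type*} (G : WeightedGraph V) (u v : V) : 0 ≤ G.w u v := by
  by_cases h : G.Adj u v
  · exact (G.w_pos u v h).le
  · exact (G.w_eq_zero u v h).ge

/-- The (weighted) degree `d_u`. -/
def deg (u : V) : ℝ := ∑ v, G.w u v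

theorem deg_pos (u : V) : 0 < G.deg u := by
  obtain ⟨v, hv⟩ := G.exists_adj u
  exact Finset.sum_pos' (fun x _ => G.w_nonneg u x) ⟨v, Finset.mem_univ v, G.w_pos u v hv⟩

/-- The space `l²(V, μ)` of real functions on the vertices, where `μ(u) = d_u`. -/
def L2 {V : Type*} (_G : WeightedGraph V) : Type _ := V → ℝ

instance : AddCommGroup G.L2 := inferInstanceAs (AddCommGroup (V → ℝ))

instance : Module ℝ G.L2 := inferInstanceAs (Module ℝ (V → ℝ))

instance : FiniteDimensional ℝ G.L2 := inferInstanceAs (FiniteDimensional ℝ (V → ℝ))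

theorem finrank_L2 : Module.finrank ℝ G.L2 = Fintype.card V :=
  Module.finrank_fintype_fun_eq_card ℝ

/-- The inner product `(f, g)_μ = ∑ u, μ(u) f(u) g(u)`. -/
@[reducible] def innerCore : InnerProductSpace.Core ℝ G.L2 where
  inner f g := ∑ u, G.deg u * f u * g u
  conj_inner_symm f g := by
    simp only [conj_trivial]
    exact Finset.sum_congr rfl fun u _ => by ring
  re_inner_nonneg f := by
    simp only [RCLike.re_to_real]
    exact Finset.sum_nonneg fun u _ => by
      rw [mul_assoc]; exact mul_nonneg (G.deg_pos u).le (mul_self_nonneg _)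
  add_left f g h := by
    rw [← Finset.sum_add_distrib]
    refine Finset.sum_congr rfl fun u _ => ?_
    change G.deg u * (f u + g u) * h u = _
    ring
  smul_left f g r := by
    rw [Finset.mul_sum]
    refine Finset.sum_congr rfl fun u _ => ?_
    change G.deg u * (r * f u) * g u = r * _
    ring
  definite f hf := by
    have h0 : ∀ u ∈ Finset.univ, 0 ≤ G.deg u * f u * f u := fun u _ => by
      rw [mul_assoc]; exact mul_nonneg (G.deg_pos u).le (mul_self_nonneg _)
    funext u
    have h := (Finset.sum_eq_zero_iff_of_nonneg h0).1 hf u (Finset.mem_univ u)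
    rw [mul_assoc] at h
    exact mul_self_eq_zero.1 ((mul_eq_zero.1 h).resolve_left (G.deg_pos u).ne')

instance : NormedAddCommGroup G.L2 := G.innerCore.toNormedAddCommGroup

instance : InnerProductSpace ℝ G.L2 := InnerProductSpace.ofCore G.innerCore.toCore

theorem inner_def (f g : G.L2) : inner ℝ f g = ∑ u, G.deg u * f u * g u := rfl

/-- The normalized Laplacian `Δ f(u) = (1 / d_u) ∑ v, w_{uv} (f(u) - f(v))`. -/
def laplacian : G.L2 →ₗ[ℝ] G.L2 where
  toFun f := fun u => 1 / G.deg u * ∑ v, G.w u v * (f u - f v)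
  map_add' f g := by
    funext u
    change _ = 1 / G.deg u * _ + 1 / G.deg u * _
    rw [← mul_add, ← Finset.sum_add_distrib]
    congr 1
    refine Finset.sum_congr rfl fun v _ => ?_
    change G.w u v * ((f u + g u) - (f v + g v)) = _
    ring
  map_smul' r f := by
    funext u
    change 1 / G.deg u * ∑ v, G.w u v * (r * f u - r * f v)
      = r * (1 / G.deg u * ∑ v, G.w u v * (f u - f v))
    rw [mul_left_comm, Finset.mul_sum (a := r)]
    congr 1
    exact Finset.sum_congr rfl fun v _ => by ring

theorem laplacian_apply (f : G.L2) (u : V) :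
    G.laplacian f u = 1 / G.deg u * ∑ v, G.w u v * (f u - f v) := rfl

theorem laplacian_isSymmetric : G.laplacian.IsSymmetric := by
  intro f g
  have hL : inner ℝ (G.laplacian f) g = ∑ u, ∑ v, G.w u v * (f u - f v) * g u := by
    rw [inner_def]
    refine Finset.sum_congr rfl fun u _ => ?_
    rw [laplacian_apply, ← mul_assoc, mul_one_div_cancel (G.deg_pos u).ne', one_mul,
      Finset.sum_mul]
  have hR : inner ℝ f (G.laplacian g) = ∑ u, ∑ v, G.w u v * (g u - g v) * f u := by
    rw [inner_def]
    refine Finset.sum_congr rfl fun u _ => ?_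
    rw [laplacian_apply, mul_right_comm, ← mul_assoc, mul_one_div_cancel (G.deg_pos u).ne',
      one_mul, Finset.sum_mul]
  have hS : ∑ u, ∑ v, G.w u v * f v * g u = ∑ u, ∑ v, G.w u v * g v * f u := by
    rw [Finset.sum_comm]
    refine Finset.sum_congr rfl fun u _ => Finset.sum_congr rfl fun v _ => ?_
    rw [G.w_symm v u]; ring
  change inner ℝ (G.laplacian f) g = inner ℝ f (G.laplacian g)
  rw [hL, hR, ← sub_eq_zero]
  have key : ∀ u v, G.w u v * (f u - f v) * g u - G.w u v * (g u - g v) * f u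
      = G.w u v * g v * f u - G.w u v * f v * g u := fun u v => by ring
  simp only [← Finset.sum_sub_distrib, key]
  simp only [Finset.sum_sub_distrib, hS, sub_self]

/-- The eigenvalues `λ_1 ≤ λ_2 ≤ ⋯ ≤ λ_N` of the normalized Laplacian, counted with multiplicity,
where `N` is the number of vertices (the index starts at `1`; the value is `0` outside `1, …, N`).
Mathlib lists the eigenvalues of a symmetric operator in decreasing order, with indices starting at
`0`, so that `λ_k` is the entry with index `N - k`. -/
def eigenvalue (k : ℕ) : ℝ :=
  if h : 1 ≤ k ∧ k ≤ Fintype.card V then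
    G.laplacian_isSymmetric.eigenvalues G.finrank_L2 ⟨Fintype.card V - k, by omega⟩
  else 0

end Spectrum

section DualCheeger

variable {V : Type*} [Fintype V] [DecidableEq V] (G : WeightedGraph V)

/-- `|E(S, T)| = ∑_{u ∈ S, v ∈ T} w_{uv}`. -/
def cut {V : Type*} (G : WeightedGraph V) (S T : Finset V) : ℝ := ∑ u ∈ S, ∑ v ∈ T, G.w u v

/-- `vol(S) = ∑_{u ∈ S} d_u`. -/
def vol {V : Type*} [Fintype V] (G : WeightedGraph V) (S : Finset V) : ℝ := ∑ u ∈ S, G.deg u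

/-- `2 |E(S, T)| / vol(S ∪ T)`. -/
def dualExpansion (S T : Finset V) : ℝ := 2 * G.cut S T / G.vol (S ∪ T)

/-- `k` pairs of vertex sets, the `i`-th pair being `P (i, 0), P (i, 1)`, such that all `2k` sets
are mutually disjoint and no pair has an empty union. -/
def IsSubBipartition {V : Type*} [DecidableEq V] {k : ℕ} (P : Fin k × Fin 2 → Finset V) : Prop :=
  (∀ p q, p ≠ q → P p ∩ P q = ∅) ∧ ∀ i, P (i, 0) ∪ P (i, 1) ≠ ∅

/-- The `k`-way dual Cheeger constant, for `1 ≤ k ≤ N`: the maximum over all `k`-sub-bipartitions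
of the minimum of the `k` dual expansions. It is a supremum over a finite set, which is non-empty
exactly because `k ≤ N`. -/
def dualCheeger (k : ℕ) : ℝ :=
  ⨆ P : {P : Fin k × Fin 2 → Finset V // IsSubBipartition P},
    ⨅ i : Fin k, G.dualExpansion (P.1 (i, 0)) (P.1 (i, 1))

end DualCheeger

end

end WeightedGraph

/-! The form of 2 - Δ is the signless energy E(f), the sum over edges of w(f(u)+f(v))², so `topGap
k` is the k-th smallest eigenvalue of 2 - Δ, and the task is a Cheeger inequality for E. Two
independent results are multiplied.

Localization (`exists_disjoint_signlessEnergy_le`): k disjointly supported functions have E(g) ≤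
O(k⁵) `topGap k` ‖g‖². The top k eigenfunctions embed V in ℝᵏ, and the embedding is projected
radially to the sphere. By orthonormality the embedding has total mass k but mass 1 in each
direction, so a small cell, taken together with its antipode, carries mass barely above 1. Cells can
therefore be grouped into k families of mass at least 1/2, and cutting off to each family costs
little energy. A random partition is replaced by averaging over finitely many staircase coordinates.

Improved Cheeger for one function (`exists_dualExpansion_of_signlessEnergy`): f has level sets S in
{f > 0} and T in {f < 0} with 1 - `dualExpansion` = O(l E(f)/(‖f‖² √`topGap l`)). Thresholds cut [0,
max |f|] into bands. If 2l bands were not enough, l of the tent functions on them would have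
Rayleigh quotients too small for `topGap l`. Hence f is close to a step function. The coarea
argument is applied to η(f), where η' is the distance to the thresholds: η(f) costs energy only in
proportion to that distance, yet |η(f)| dominates f²/(16l).

Applying the second result to each g gives k disjoint pairs (S, T). -/

namespace WeightedGraph

/-! ### Signless energy and variational bounds for the top of the spectrum. -/

section Spectral

variable {V : Type*} [Fintype V] (G : WeightedGraph V)

/-- The quadratic form of the signless Laplacian, `∑_{uv} w_{uv} (f(u) + f(v))²` over the edges. -/
noncomputable def signlessEnergy (f : V → ℝ) : ℝ := 1 / 2 * ∑ u, ∑ v, G.w u v * (f u + f v) ^ 2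

/-- The squared norm of `f` in `l²(V, d)`. -/
noncomputable def sqNorm (f : V → ℝ) : ℝ := ∑ u, G.deg u * f u ^ 2

theorem signlessEnergy_nonneg (f : V → ℝ) : 0 ≤ G.signlessEnergy f :=
  mul_nonneg (by norm_num) (Finset.sum_nonneg fun u _ => Finset.sum_nonneg fun v _ =>
    mul_nonneg (G.w_nonneg u v) (sq_nonneg _))

theorem sqNorm_nonneg (f : V → ℝ) : 0 ≤ G.sqNorm f :=
  Finset.sum_nonneg fun u _ => mul_nonneg (G.deg_pos u).le (sq_nonneg _)

theorem sum_w_fst (g : V → ℝ) : ∑ u, ∑ v, G.w u v * g u = ∑ u, G.deg u * g u :=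
  Finset.sum_congr rfl fun u _ => by rw [deg, Finset.sum_mul]

theorem sum_w_snd (g : V → ℝ) : ∑ u, ∑ v, G.w u v * g v = ∑ u, G.deg u * g u := by
  rw [Finset.sum_comm, ← sum_w_fst]
  exact Finset.sum_congr rfl fun u _ => Finset.sum_congr rfl fun v _ => by rw [G.w_symm]

theorem signlessEnergy_le_two_mul_sqNorm (f : V → ℝ) :
    G.signlessEnergy f ≤ 2 * G.sqNorm f := by
  have h1 := G.sum_w_fst (fun u => f u ^ 2)
  have h2 := G.sum_w_snd (fun u => f u ^ 2)
  have h3 : ∑ u, ∑ v, G.w u v * (f u + f v) ^ 2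
      ≤ ∑ u, ∑ v, (2 * (G.w u v * f u ^ 2) + 2 * (G.w u v * f v ^ 2)) := by
    refine Finset.sum_le_sum fun u _ => Finset.sum_le_sum fun v _ => ?_
    nlinarith [mul_nonneg (G.w_nonneg u v) (sq_nonneg (f u - f v))]
  simp only [Finset.sum_add_distrib, ← Finset.mul_sum] at h3
  unfold signlessEnergy sqNorm
  linarith

theorem inner_self_eq_sqNorm (f : G.L2) : inner ℝ f f = G.sqNorm f := by
  rw [inner_def]; unfold sqNorm
  exact Finset.sum_congr rfl fun u _ => by ring

theorem inner_laplacian_self (f : G.L2) :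
    inner ℝ (G.laplacian f) f = 2 * G.sqNorm f - G.signlessEnergy f := by
  have hL : inner ℝ (G.laplacian f) f = ∑ u, ∑ v, G.w u v * ((f u - f v) * f u) := by
    rw [inner_def]
    refine Finset.sum_congr rfl fun u _ => ?_
    rw [laplacian_apply, ← mul_assoc, mul_one_div_cancel (G.deg_pos u).ne', one_mul,
      Finset.sum_mul]
    exact Finset.sum_congr rfl fun v _ => by ring
  have h1 := G.sum_w_fst (fun u => f u ^ 2)
  have h2 := G.sum_w_snd (fun u => f u ^ 2)
  have h3 : ∑ u, ∑ v, G.w u v * (f u + f v) ^ 2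
      = ∑ u, ∑ v, (G.w u v * f u ^ 2 + 2 * (G.w u v * (f u * f v)) + G.w u v * f v ^ 2) :=
    Finset.sum_congr rfl fun u _ => Finset.sum_congr rfl fun v _ => by ring
  have h4 : ∑ u, ∑ v, G.w u v * ((f u - f v) * f u)
      = ∑ u, ∑ v, (G.w u v * f u ^ 2 - G.w u v * (f u * f v)) :=
    Finset.sum_congr rfl fun u _ => Finset.sum_congr rfl fun v _ => by ring
  simp only [Finset.sum_add_distrib, Finset.sum_sub_distrib, ← Finset.mul_sum] at h3 h4
  unfold sqNorm signlessEnergy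
  rw [hL, h4, h3]
  linarith

/-- The spectral gap `2 - λ_{N-k+1}` at the top of the spectrum. -/
noncomputable def topGap (k : ℕ) : ℝ := 2 - G.eigenvalue (Fintype.card V - k + 1)

/-- In the decreasing list, λ_{N-k+1} has index N - (N-k+1) = k - 1. -/
theorem topGap_eq {k : ℕ} (hk : 1 ≤ k) (hkN : k ≤ Fintype.card V) :
    G.topGap k = 2 - G.laplacian_isSymmetric.eigenvalues G.finrank_L2 ⟨k - 1, by omega⟩ := by
  rw [topGap, eigenvalue, dif_pos (by omega)]
  congr 3
  omega

theorem inner_laplacian_eigenvectorBasis (i j : Fin (Fintype.card V)) :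
    inner ℝ (G.laplacian (G.laplacian_isSymmetric.eigenvectorBasis G.finrank_L2 i))
      (G.laplacian_isSymmetric.eigenvectorBasis G.finrank_L2 j) =
    if i = j then G.laplacian_isSymmetric.eigenvalues G.finrank_L2 i else 0 := by
  rw [LinearMap.IsSymmetric.apply_eigenvectorBasis, real_inner_smul_left,
    OrthonormalBasis.inner_eq_ite]
  simp

theorem exists_orthonormal_signlessEnergy_le {k : ℕ} (hk : 1 ≤ k) (hkN : k ≤ Fintype.card V) :
    ∃ f : Fin k → V → ℝ, (∀ i j, ∑ u, G.deg u * f i u * f j u = if i = j then 1 else 0) ∧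
      ∀ i, G.signlessEnergy (f i) ≤ G.topGap k := by
  let b := G.laplacian_isSymmetric.eigenvectorBasis G.finrank_L2
  refine ⟨fun i => b (Fin.castLE hkN i), fun i j => ?_, fun i => ?_⟩
  · have h := OrthonormalBasis.inner_eq_ite b (Fin.castLE hkN i) (Fin.castLE hkN j)
    rw [inner_def] at h
    simpa using h
  · have h1 := G.inner_laplacian_self (b (Fin.castLE hkN i))
    have h2 := OrthonormalBasis.inner_eq_ite b (Fin.castLE hkN i) (Fin.castLE hkN i)
    rw [inner_laplacian_eigenvectorBasis] at h1
    rw [inner_self_eq_sqNorm] at h2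
    have h3 := G.laplacian_isSymmetric.eigenvalues_antitone G.finrank_L2
      (show Fin.castLE hkN i ≤ ⟨k - 1, by omega⟩ from by
        rw [Fin.le_def]; simp; omega)
    rw [G.topGap_eq hk hkN]
    simp only [if_true] at h1 h2
    rw [h2] at h1
    linarith

theorem topGap_le_two {k : ℕ} (hk : 1 ≤ k) (hkN : k ≤ Fintype.card V) : G.topGap k ≤ 2 := by
  let b := G.laplacian_isSymmetric.eigenvectorBasis G.finrank_L2
  have h1 := G.inner_laplacian_self (b ⟨k - 1, by omega⟩)
  have h2 := OrthonormalBasis.inner_eq_ite b ⟨k - 1, by omega⟩ ⟨k - 1, by omega⟩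
  rw [inner_laplacian_eigenvectorBasis] at h1
  rw [inner_self_eq_sqNorm] at h2
  have h3 := G.signlessEnergy_le_two_mul_sqNorm (b ⟨k - 1, by omega⟩)
  rw [G.topGap_eq hk hkN]
  simp only [if_true] at h1 h2
  linarith

theorem topGap_nonneg {k : ℕ} (hk : 1 ≤ k) (hkN : k ≤ Fintype.card V) : 0 ≤ G.topGap k := by
  obtain ⟨f, -, hf⟩ := G.exists_orthonormal_signlessEnergy_le hk hkN
  exact (G.signlessEnergy_nonneg _).trans (hf ⟨0, hk⟩)

theorem topGap_mono {k l : ℕ} (hk : 1 ≤ k) (hkl : k ≤ l) (hl : l ≤ Fintype.card V) :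
    G.topGap k ≤ G.topGap l := by
  rw [G.topGap_eq hk (hkl.trans hl), G.topGap_eq (hk.trans hkl) hl]
  have := G.laplacian_isSymmetric.eigenvalues_antitone G.finrank_L2
      (show (⟨k - 1, by omega⟩ : Fin (Fintype.card V)) ≤ ⟨l - 1, by omega⟩ from by
        rw [Fin.le_def]; simp; omega)
  linarith

/-- The easy half of Courant–Fischer: expand in the eigenbasis; only eigenvalues from index l - 1 on
contribute, and these are at most the one at l - 1. -/
theorem topGap_mul_sqNorm_le {l : ℕ} (hl : 1 ≤ l) (hlN : l ≤ Fintype.card V) (g : G.L2)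
    (hg : ∀ i : Fin (Fintype.card V), i.1 < l - 1 →
      inner ℝ (G.laplacian_isSymmetric.eigenvectorBasis G.finrank_L2 i) g = 0) :
    G.topGap l * G.sqNorm g ≤ G.signlessEnergy g := by
  let b := G.laplacian_isSymmetric.eigenvectorBasis G.finrank_L2
  have h1 := G.inner_laplacian_self g
  have h2 := b.sum_inner_mul_inner g g
  have h3 := b.sum_inner_mul_inner (G.laplacian g) g
  have h4 : ∀ i, inner ℝ (G.laplacian g) (b i) * inner ℝ (b i) g
      ≤ G.laplacian_isSymmetric.eigenvalues G.finrank_L2 ⟨l - 1, by omega⟩ *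
        (inner ℝ g (b i) * inner ℝ (b i) g) := by
    intro i
    have e : inner ℝ (G.laplacian g) (b i)
        = G.laplacian_isSymmetric.eigenvalues G.finrank_L2 i * inner ℝ g (b i) := by
      rw [G.laplacian_isSymmetric g (b i), LinearMap.IsSymmetric.apply_eigenvectorBasis,
        real_inner_smul_right]
      rfl
    by_cases hi : i.1 < l - 1
    · have := hg i hi
      change inner ℝ (b i) g = 0 at this
      simp [this]
    · rw [e, mul_assoc]
      have h5 : 0 ≤ inner ℝ g (b i) * inner ℝ (b i) g := by
        rw [real_inner_comm]; exact mul_self_nonneg _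
      exact mul_le_mul_of_nonneg_right (G.laplacian_isSymmetric.eigenvalues_antitone G.finrank_L2
        (by rw [Fin.le_def]; simp; omega)) h5
  have h6 := Finset.sum_le_sum fun i (_ : i ∈ Finset.univ) => h4 i
  rw [← Finset.mul_sum, h2, h3, h1, inner_self_eq_sqNorm] at h6
  rw [G.topGap_eq hl hlN]
  linarith

theorem sqNorm_sum_of_disjoint {ι : Type*} [Fintype ι] (g : ι → V → ℝ) (c : ι → ℝ)
    (hd : ∀ i j, i ≠ j → ∀ u, g i u = 0 ∨ g j u = 0) :
    G.sqNorm (fun u => ∑ i, c i * g i u) = ∑ i, c i ^ 2 * G.sqNorm (g i) := by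
  unfold sqNorm
  simp only [Finset.mul_sum]
  rw [Finset.sum_comm]
  refine Finset.sum_congr rfl fun u _ => ?_
  rw [sq (∑ i, c i * g i u), Finset.sum_mul_sum, Finset.mul_sum]
  refine Finset.sum_congr rfl fun i _ => ?_
  rw [Finset.sum_eq_single i]
  · ring
  · intro j _ hj
    rcases hd i j hj.symm u with h | h <;> simp [h]
  · simp

theorem card_filter_ne_zero_le_one {ι : Type*} [Fintype ι] (z : ι → ℝ)
    (hz : ∀ i j, i ≠ j → z i = 0 ∨ z j = 0) : (Finset.univ.filter fun i => z i ≠ 0).card ≤ 1 := by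
  rw [Finset.card_le_one]
  intro i hi j hj
  by_contra hij
  simp only [Finset.mem_filter] at hi hj
  exact (hz i j hij).elim hi.2 hj.2

/-- At most one x and one y are nonzero, so the sum has at most two nonzero terms and Cauchy–Schwarz
costs a factor 2. In use, x and y are the values of disjointly supported functions at the two ends
of an edge. -/
theorem sq_sum_add_le_of_disjoint {ι : Type*} [Fintype ι] (x y : ι → ℝ)
    (hx : ∀ i j, i ≠ j → x i = 0 ∨ x j = 0) (hy : ∀ i j, i ≠ j → y i = 0 ∨ y j = 0) :
    (∑ i, (x i + y i)) ^ 2 ≤ 2 * ∑ i, (x i + y i) ^ 2 := by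
  classical
  set s := Finset.univ.filter fun i => x i ≠ 0 with hs
  set t := Finset.univ.filter fun i => y i ≠ 0 with ht
  have h1 : ∀ i, i ∉ s ∪ t → x i + y i = 0 := by
    intro i hi
    simp only [hs, ht, Finset.mem_union, Finset.mem_filter, Finset.mem_univ, true_and, not_or,
      ne_eq, not_not] at hi
    rw [hi.1, hi.2, add_zero]
  have h2 : ∑ i, (x i + y i) = ∑ i ∈ s ∪ t, (x i + y i) :=
    (Finset.sum_subset (Finset.subset_univ _) fun i _ hi => h1 i hi).symm
  have hc : ((s ∪ t).card : ℝ) ≤ 2 := by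
    have := Finset.card_union_le s t
    have h3 : s.card ≤ 1 := card_filter_ne_zero_le_one x hx
    have h4 : t.card ≤ 1 := card_filter_ne_zero_le_one y hy
    exact_mod_cast (by omega : (s ∪ t).card ≤ 2)
  calc (∑ i, (x i + y i)) ^ 2 ≤ (s ∪ t).card * ∑ i ∈ s ∪ t, (x i + y i) ^ 2 := by
        rw [h2]; exact sq_sum_le_card_mul_sum_sq
    _ ≤ 2 * ∑ i, (x i + y i) ^ 2 := by
        refine mul_le_mul hc (Finset.sum_le_univ_sum_of_nonneg fun i => sq_nonneg _)
          (Finset.sum_nonneg fun i _ => sq_nonneg _) (by norm_num)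

theorem sum_sq_add_le_of_disjoint {ι : Type*} [Fintype ι] (x y : ι → ℝ) (L : ℝ)
    (hx : ∀ i j, i ≠ j → x i = 0 ∨ x j = 0) (hy : ∀ i j, i ≠ j → y i = 0 ∨ y j = 0)
    (hL : ∀ i, |x i + y i| ≤ L) : ∑ i, (x i + y i) ^ 2 ≤ 2 * L ^ 2 := by
  have h1 : ∀ i, (x i + y i) ^ 2
      ≤ (if x i ≠ 0 then L ^ 2 else 0) + (if y i ≠ 0 then L ^ 2 else 0) := by
    intro i
    have h2 : (x i + y i) ^ 2 ≤ L ^ 2 := sq_le_sq' (abs_le.1 (hL i)).1 (abs_le.1 (hL i)).2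
    by_cases hxi : x i = 0 <;> by_cases hyi : y i = 0
    · simp [hxi, hyi]
    · simpa [hxi, hyi] using h2
    · simpa [hxi, hyi] using h2
    · simp only [ne_eq, hxi, hyi, not_false_eq_true, if_true]
      linarith [sq_nonneg L]
  refine (Finset.sum_le_sum fun i _ => h1 i).trans ?_
  rw [Finset.sum_add_distrib, ← Finset.sum_filter, ← Finset.sum_filter, Finset.sum_const,
    Finset.sum_const, nsmul_eq_mul, nsmul_eq_mul]
  have h3 : ((Finset.univ.filter fun i => x i ≠ 0).card : ℝ) ≤ 1 := by
    exact_mod_cast card_filter_ne_zero_le_one x hx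
  have h4 : ((Finset.univ.filter fun i => y i ≠ 0).card : ℝ) ≤ 1 := by
    exact_mod_cast card_filter_ne_zero_le_one y hy
  nlinarith [sq_nonneg L]

theorem signlessEnergy_sum_of_disjoint_le {ι : Type*} [Fintype ι] (g : ι → V → ℝ) (c : ι → ℝ)
    (hd : ∀ i j, i ≠ j → ∀ u, g i u = 0 ∨ g j u = 0) :
    G.signlessEnergy (fun u => ∑ i, c i * g i u)
      ≤ 2 * ∑ i, c i ^ 2 * G.signlessEnergy (g i) := by
  have key : ∑ u, ∑ v, G.w u v * (∑ i, c i * g i u + ∑ i, c i * g i v) ^ 2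
      ≤ ∑ u, ∑ v, ∑ i, 2 * (c i ^ 2 * (G.w u v * (g i u + g i v) ^ 2)) := by
    refine Finset.sum_le_sum fun u _ => Finset.sum_le_sum fun v _ => ?_
    have h := sq_sum_add_le_of_disjoint (fun i => c i * g i u) (fun i => c i * g i v)
      (fun i j hij => by rcases hd i j hij u with h | h <;> simp [h])
      (fun i j hij => by rcases hd i j hij v with h | h <;> simp [h])
    rw [← Finset.sum_add_distrib]
    refine (mul_le_mul_of_nonneg_left h (G.w_nonneg u v)).trans (le_of_eq ?_)
    rw [Finset.mul_sum, Finset.mul_sum]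
    exact Finset.sum_congr rfl fun i _ => by ring
  have e : ∑ u, ∑ v, ∑ i, 2 * (c i ^ 2 * (G.w u v * (g i u + g i v) ^ 2))
      = 2 * ∑ i, c i ^ 2 * ∑ u, ∑ v, G.w u v * (g i u + g i v) ^ 2 := by
    simp only [Finset.mul_sum]
    rw [Finset.sum_comm_cycle]
  have e2 : ∑ i, c i ^ 2 * (1 / 2 * ∑ u, ∑ v, G.w u v * (g i u + g i v) ^ 2)
      = 1 / 2 * ∑ i, c i ^ 2 * ∑ u, ∑ v, G.w u v * (g i u + g i v) ^ 2 := by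
    rw [Finset.mul_sum]
    exact Finset.sum_congr rfl fun i _ => by ring
  unfold signlessEnergy
  rw [e2]
  linarith

/-- Disjointly supported test functions bound the spectral gap at the top from above. -/
theorem topGap_le_of_disjoint {ι : Type*} [Fintype ι] {l : ℕ} (hl : 1 ≤ l)
    (hlN : l ≤ Fintype.card V) (hι : l ≤ Fintype.card ι) (g : ι → V → ℝ)
    (hd : ∀ i j, i ≠ j → ∀ u, g i u = 0 ∨ g j u = 0) (hpos : ∀ i, 0 < G.sqNorm (g i)) (ρ : ℝ)
    (hρ : ∀ i, G.signlessEnergy (g i) ≤ ρ * G.sqNorm (g i)) : G.topGap l ≤ 2 * ρ := by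
  let b := G.laplacian_isSymmetric.eigenvectorBasis G.finrank_L2
  let A : (ι → ℝ) →ₗ[ℝ] (Fin (l - 1) → ℝ) :=
    { toFun := fun c j => ∑ i, c i * ∑ u, G.deg u * b ⟨j.1, by omega⟩ u * g i u
      map_add' := fun c c' => by
        funext j; simp [add_mul, Finset.sum_add_distrib]
      map_smul' := fun r c => by
        funext j; simp [mul_assoc, Finset.mul_sum] }
  -- More coefficients than the l - 1 orthogonality conditions: some nonzero combination is
  -- orthogonal to the top l - 1 eigenvectors.
  obtain ⟨c, hc, hc0⟩ : ∃ c, c ∈ LinearMap.ker A ∧ c ≠ 0 := by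
    refine (Submodule.ne_bot_iff _).1 (LinearMap.ker_ne_bot_of_finrank_lt ?_)
    simp only [Module.finrank_fintype_fun_eq_card, Fintype.card_fin]
    omega
  have h1 := G.topGap_mul_sqNorm_le hl hlN (fun u => ∑ i, c i * g i u) (by
    intro j hj
    have h := congrFun (LinearMap.mem_ker.1 hc) ⟨j.1, hj⟩
    change ∑ u, G.deg u * b j u * ∑ i, c i * g i u = 0
    change ∑ i, c i * ∑ u, G.deg u * b j u * g i u = 0 at h
    rw [← h]
    simp only [Finset.mul_sum]
    rw [Finset.sum_comm]
    exact Finset.sum_congr rfl fun i _ => Finset.sum_congr rfl fun u _ => by ring)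
  have h2 := G.signlessEnergy_sum_of_disjoint_le g c hd
  rw [G.sqNorm_sum_of_disjoint g c hd] at h1
  have h3 : ∑ i, c i ^ 2 * G.signlessEnergy (g i) ≤ ρ * ∑ i, c i ^ 2 * G.sqNorm (g i) := by
    rw [Finset.mul_sum]
    refine Finset.sum_le_sum fun i _ => ?_
    nlinarith [mul_le_mul_of_nonneg_left (hρ i) (sq_nonneg (c i))]
  have h4 : 0 < ∑ i, c i ^ 2 * G.sqNorm (g i) := by
    obtain ⟨i, hi⟩ := Function.ne_iff.1 hc0
    exact Finset.sum_pos' (fun j _ => mul_nonneg (sq_nonneg _) (hpos j).le)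
      ⟨i, Finset.mem_univ i, mul_pos (by positivity [show c i ≠ 0 from hi]) (hpos i)⟩
  refine le_of_mul_le_mul_right ?_ h4
  linarith

end Spectral

/-! ### From l¹ Rayleigh quotients to level sets. -/

section Coarea

variable {V : Type*} [Fintype V] (G : WeightedGraph V)

/-- Moving every nonzero value by m towards 0 reverses no sign, so nothing is lost in the triangle
inequality when m · sign is split off. -/
theorem abs_add_eq_of_shrink {a b m : ℝ} (ha : a = 0 ∨ m ≤ |a|)
    (hb : b = 0 ∨ m ≤ |b|) :
    |a + b| = |(a - m * SignType.sign a) + (b - m * SignType.sign b)|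
      + m * |(SignType.sign a : ℝ) + SignType.sign b| := by
  rcases lt_trichotomy a 0 with h | h | h <;> rcases lt_trichotomy b 0 with h' | h' | h' <;>
    simp only [sign_neg, sign_pos, sign_zero, h, h', SignType.coe_neg_one, SignType.coe_zero,
      SignType.coe_one]
  · rw [abs_of_neg h] at ha
    rw [abs_of_neg h'] at hb
    have h1 := ha.resolve_left h.ne
    have h2 := hb.resolve_left h'.ne
    rw [abs_of_neg (by linarith), abs_of_nonpos (by linarith), abs_of_neg (by norm_num)]
    ring
  · rw [abs_of_neg h] at ha
    have h1 := ha.resolve_left h.ne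
    rw [abs_of_neg (by linarith), abs_of_nonpos (by linarith), abs_of_neg (by norm_num)]
    ring
  · norm_num
  · rw [abs_of_neg h'] at hb
    have h2 := hb.resolve_left h'.ne
    rw [abs_of_neg (by linarith), abs_of_nonpos (by linarith), abs_of_neg (by norm_num)]
    ring
  · norm_num
  · rw [abs_of_pos h'] at hb
    have h2 := hb.resolve_left h'.ne'
    rw [abs_of_pos (by linarith), abs_of_nonneg (by linarith), abs_of_pos (by norm_num)]
    ring
  · norm_num
  · rw [abs_of_pos h] at ha
    have h1 := ha.resolve_left h.ne'
    rw [abs_of_pos (by linarith), abs_of_nonneg (by linarith), abs_of_pos (by norm_num)]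
    ring
  · rw [abs_of_pos h] at ha
    rw [abs_of_pos h'] at hb
    have h1 := ha.resolve_left h.ne'
    have h2 := hb.resolve_left h'.ne'
    rw [abs_of_pos (by linarith), abs_of_nonneg (by linarith), abs_of_pos (by norm_num)]
    ring

theorem abs_shrink {a m : ℝ} (ha : a = 0 ∨ m ≤ |a|) :
    |a| = |a - m * SignType.sign a| + m * |(SignType.sign a : ℝ)| := by
  rcases lt_trichotomy a 0 with h | h | h
  · rw [abs_of_neg h] at ha ⊢
    have : m ≤ -a := ha.resolve_left h.ne
    simp only [sign_neg h, SignType.coe_neg_one, abs_neg, abs_one]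
    rw [abs_of_nonpos (by linarith)]; ring
  · simp [h]
  · rw [abs_of_pos h] at ha ⊢
    have : m ≤ a := ha.resolve_left h.ne'
    simp only [sign_pos h, SignType.coe_one, abs_one]
    rw [abs_of_nonneg (by linarith)]; ring

variable [DecidableEq V]

theorem vol_sign (h : V → ℝ) :
    G.vol (Finset.univ.filter (0 < h ·) ∪ Finset.univ.filter (h · < 0))
    = ∑ u, G.deg u * |(SignType.sign (h u) : ℝ)| := by
  rw [vol, ← Finset.filter_or, Finset.sum_filter]
  refine Finset.sum_congr rfl fun u _ => ?_
  rcases lt_trichotomy (h u) 0 with h' | h' | h' <;> simp [h']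

/-- For signs, |a + b| = |a| + |b| unless they are opposite, where 2 is lost; those edges are
exactly the cut. -/
theorem vol_sub_two_mul_cut_sign (h : V → ℝ) :
    G.vol (Finset.univ.filter (0 < h ·) ∪ Finset.univ.filter (h · < 0))
      - 2 * G.cut (Finset.univ.filter (0 < h ·)) (Finset.univ.filter (h · < 0))
    = 1 / 2 * ∑ u, ∑ v, G.w u v * |(SignType.sign (h u) : ℝ) + SignType.sign (h v)| := by
  have hcut : G.cut (Finset.univ.filter (0 < h ·)) (Finset.univ.filter (h · < 0))
      = ∑ u, ∑ v, G.w u v * (if 0 < h u ∧ h v < 0 then 1 else 0) := by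
    rw [cut, Finset.sum_filter]
    refine Finset.sum_congr rfl fun u _ => ?_
    rw [Finset.sum_filter]
    by_cases hu : 0 < h u <;> simp [hu]
  have hcut' : G.cut (Finset.univ.filter (0 < h ·)) (Finset.univ.filter (h · < 0))
      = ∑ u, ∑ v, G.w u v * (if 0 < h v ∧ h u < 0 then 1 else 0) := by
    rw [hcut, Finset.sum_comm]
    exact Finset.sum_congr rfl fun u _ => Finset.sum_congr rfl fun v _ => by rw [G.w_symm]
  have h1 := G.sum_w_fst (fun u => |(SignType.sign (h u) : ℝ)|)
  have h2 := G.sum_w_snd (fun u => |(SignType.sign (h u) : ℝ)|)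
  have key : ∑ u, ∑ v, G.w u v * |(SignType.sign (h u) : ℝ) + SignType.sign (h v)|
      = ∑ u, ∑ v, (G.w u v * |(SignType.sign (h u) : ℝ)| + G.w u v * |(SignType.sign (h v) : ℝ)|
        - 2 * (G.w u v * (if 0 < h u ∧ h v < 0 then 1 else 0))
        - 2 * (G.w u v * (if 0 < h v ∧ h u < 0 then 1 else 0))) := by
    refine Finset.sum_congr rfl fun u _ => Finset.sum_congr rfl fun v _ => ?_
    rcases lt_trichotomy (h u) 0 with hu | hu | hu <;>
      rcases lt_trichotomy (h v) 0 with hv | hv | hv <;>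
      simp [hu, hv, hu.not_gt, hv.not_gt] <;> norm_num <;> ring
  simp only [Finset.sum_add_distrib, Finset.sum_sub_distrib, ← Finset.mul_sum] at key
  rw [vol_sign, key, ← hcut, ← hcut', h1, h2]
  ring

/-- The coarea argument: some pair of level sets has a dual expansion controlled by the `l¹`
Rayleigh quotient of the signless Laplacian. -/
theorem exists_one_sub_dualExpansion_le (c : ℝ) (h : V → ℝ) (h0 : h ≠ 0)
    (hc : 1 / 2 * ∑ u, ∑ v, G.w u v * |h u + h v| ≤ c * ∑ u, G.deg u * |h u|) :
    ∃ S T : Finset V, (∀ u ∈ S, 0 < h u) ∧ (∀ u ∈ T, h u < 0) ∧ S ∪ T ≠ ∅ ∧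
      1 - G.dualExpansion S T ≤ c := by
  -- Induction on the support replaces integration over levels. With m the least nonzero |h|, either
  -- sign(h) satisfies the bound, and its level sets are the answer, or subtracting m · sign(h)
  -- keeps the bound, now strict (so the rest is nonzero), on a smaller support.
  induction hn : (Finset.univ.filter fun u => h u ≠ 0).card using Nat.strong_induction_on
    generalizing h with
  | _ n ih =>
  obtain ⟨u0, hu0⟩ := Function.ne_iff.1 h0
  obtain ⟨u1, hu1, hmin⟩ := Finset.exists_min_image (Finset.univ.filter fun u => h u ≠ 0)
    (fun u => |h u|) ⟨u0, by simpa using hu0⟩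
  simp only [Finset.mem_filter, Finset.mem_univ, true_and] at hu1 hmin
  set m := |h u1| with hm
  have hm0 : 0 < m := abs_pos.2 hu1
  have hmle : ∀ u, h u = 0 ∨ m ≤ |h u| := fun u => by
    by_cases hu : h u = 0
    · exact Or.inl hu
    · exact Or.inr (hmin u hu)
  by_cases hχ : 1 / 2 * ∑ u, ∑ v, G.w u v * |(SignType.sign (h u) : ℝ) + SignType.sign (h v)|
      ≤ c * ∑ u, G.deg u * |(SignType.sign (h u) : ℝ)|
  · refine ⟨Finset.univ.filter (0 < h ·), Finset.univ.filter (h · < 0), by simp, by simp, ?_, ?_⟩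
    · refine Finset.nonempty_iff_ne_empty.1 ⟨u0, ?_⟩
      simpa [lt_or_lt_iff_ne, or_comm] using hu0
    · rw [← vol_sub_two_mul_cut_sign, ← vol_sign] at hχ
      have hv : 0 < G.vol (Finset.univ.filter (0 < h ·) ∪ Finset.univ.filter (h · < 0)) :=
        Finset.sum_pos (fun u _ => G.deg_pos u) ⟨u0, by
          simpa [lt_or_lt_iff_ne, or_comm] using hu0⟩
      rw [dualExpansion, sub_le_comm, le_div_iff₀ hv]
      linarith
  · set h' : V → ℝ := fun u => h u - m * SignType.sign (h u) with hh'
    have e1 : ∑ u, ∑ v, G.w u v * |h u + h v| = ∑ u, ∑ v, G.w u v * |h' u + h' v|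
        + m * ∑ u, ∑ v, G.w u v * |(SignType.sign (h u) : ℝ) + SignType.sign (h v)| := by
      simp only [Finset.mul_sum, ← Finset.sum_add_distrib]
      refine Finset.sum_congr rfl fun u _ => Finset.sum_congr rfl fun v _ => ?_
      rw [abs_add_eq_of_shrink (hmle u) (hmle v)]
      ring
    have e2 : ∑ u, G.deg u * |h u| = ∑ u, G.deg u * |h' u|
        + m * ∑ u, G.deg u * |(SignType.sign (h u) : ℝ)| := by
      simp only [Finset.mul_sum, ← Finset.sum_add_distrib]
      refine Finset.sum_congr rfl fun u _ => ?_
      rw [abs_shrink (hmle u)]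
      ring
    rw [e1, e2] at hc
    rw [not_le] at hχ
    have hχ' := mul_lt_mul_of_pos_left hχ hm0
    have hlt : 1 / 2 * ∑ u, ∑ v, G.w u v * |h' u + h' v| < c * ∑ u, G.deg u * |h' u| := by
      linarith
    have hsgn : ∀ u, (0 < h' u → 0 < h u) ∧ (h' u < 0 → h u < 0) := by
      intro u
      rcases lt_trichotomy (h u) 0 with hu | hu | hu
      · have h1 := (hmle u).resolve_left hu.ne
        rw [abs_of_neg hu] at h1
        simp only [hh', sign_neg hu, SignType.coe_neg_one]
        exact ⟨fun h2 => by linarith, fun _ => hu⟩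
      · simp [hh', hu]
      · have h1 := (hmle u).resolve_left hu.ne'
        rw [abs_of_pos hu] at h1
        simp only [hh', sign_pos hu, SignType.coe_one]
        exact ⟨fun _ => hu, fun h2 => by linarith⟩
    have hne : h' ≠ 0 := by
      rintro h2
      simp [h2] at hlt
    obtain ⟨S, T, hS, hT, hST, hle⟩ := ih _ (by
      rw [← hn]
      refine Finset.card_lt_card (Finset.ssubset_iff.2 ⟨u1, ?_, ?_⟩)
      · simp only [Finset.mem_filter, Finset.mem_univ, true_and, ne_eq, not_not, hh', hm]
        rcases lt_or_gt_of_ne hu1 with hu | hu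
        · simp [sign_neg hu, abs_of_neg hu]
        · simp [sign_pos hu, abs_of_pos hu]
      · intro u hu
        simp only [Finset.mem_insert, Finset.mem_filter, Finset.mem_univ, true_and] at hu ⊢
        rcases hu with rfl | hu
        · exact hu1
        · rcases lt_or_gt_of_ne hu with h3 | h3
          · exact ((hsgn u).2 h3).ne
          · exact ((hsgn u).1 h3).ne') h' hne hlt.le rfl
    exact ⟨S, T, fun u hu => (hsgn u).1 (hS u hu), fun u hu => (hsgn u).2 (hT u hu), hST, hle⟩

end Coarea

/-! ### Thresholds, tents on bands, and the primitive of the distance to the thresholds. -/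

section Tent

/-- The tent function of the interval `[s, t]`: the distance to the complement of the interval. -/
noncomputable def tent (s t x : ℝ) : ℝ := max 0 (min (x - s) (t - x))

theorem tent_nonneg (s t x : ℝ) : 0 ≤ tent s t x := le_max_left _ _

theorem tent_eq_zero_of_le_left {s t x : ℝ} (h : x ≤ s) : tent s t x = 0 :=
  max_eq_left ((min_le_left _ _).trans (by linarith))

theorem tent_eq_zero_of_right_le {s t x : ℝ} (h : t ≤ x) : tent s t x = 0 :=
  max_eq_left ((min_le_right _ _).trans (by linarith))

theorem tent_self (s x : ℝ) : tent s s x = 0 :=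
  (le_total x s).elim tent_eq_zero_of_le_left tent_eq_zero_of_right_le

theorem abs_tent_sub_le (s t x y : ℝ) : |tent s t x - tent s t y| ≤ |x - y| := by
  refine (abs_max_sub_max_le_max _ _ _ _).trans (max_le (by simp) ?_)
  refine (abs_min_sub_min_le_max _ _ _ _).trans (max_le (le_of_eq ?_) (le_of_eq ?_))
  · congr 1; ring
  · rw [abs_sub_comm]; congr 1; ring

theorem continuous_tent (s t : ℝ) : Continuous (tent s t) := by
  unfold tent; fun_prop

theorem continuous_tent_right (s x : ℝ) : Continuous fun t => tent s t x := by
  unfold tent; fun_prop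

/-- The odd extension of the tent function. -/
noncomputable def oddTent (s t x : ℝ) : ℝ := tent s t x - tent s t (-x)

theorem oddTent_sq {s : ℝ} (hs : 0 ≤ s) (t x : ℝ) : oddTent s t x ^ 2 = tent s t |x| ^ 2 := by
  unfold oddTent
  rcases le_total 0 x with h | h
  · rw [abs_of_nonneg h, tent_eq_zero_of_le_left (x := -x) (by linarith), sub_zero]
  · rw [abs_of_nonpos h, tent_eq_zero_of_le_left (x := x) (by linarith)]
    ring

/-- By oddness the sum is a difference of values at x and -y; each of the two 1-Lipschitz tents
contributes |x + y|. -/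
theorem abs_oddTent_add_le (s t x y : ℝ) : |oddTent s t x + oddTent s t y| ≤ 2 * |x + y| := by
  have h1 := abs_tent_sub_le s t x (-y)
  have h2 := abs_tent_sub_le s t (-x) y
  rw [sub_neg_eq_add] at h1
  rw [show -x - y = -(x + y) by ring, abs_neg] at h2
  have h3 : oddTent s t x + oddTent s t y
      = (tent s t x - tent s t (-y)) - (tent s t (-x) - tent s t y) := by unfold oddTent; ring
  rw [h3]
  exact (abs_sub _ _).trans (by linarith)

theorem tent_disjoint {t : ℕ → ℝ} (ht : Monotone t) {i j : ℕ} (hij : i ≠ j) (x : ℝ) :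
    tent (t i) (t (i + 1)) x = 0 ∨ tent (t j) (t (j + 1)) x = 0 := by
  wlog h : i < j generalizing i j
  · exact (this hij.symm (by omega)).symm
  · rcases le_total x (t j) with hx | hx
    · exact Or.inr (tent_eq_zero_of_le_left hx)
    · exact Or.inl (tent_eq_zero_of_right_le ((ht (by omega)).trans hx))

/-- The distance to the thresholds `±t_0, …, ±t_m`, cut off outside `[-t_m, t_m]`. -/
noncomputable def bandDist (t : ℕ → ℝ) (m : ℕ) (x : ℝ) : ℝ :=
  ∑ i : Fin m, tent (t i) (t (i + 1)) |x|

theorem bandDist_nonneg (t : ℕ → ℝ) (m : ℕ) (x : ℝ) : 0 ≤ bandDist t m x :=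
  Finset.sum_nonneg fun _ _ => tent_nonneg _ _ _

theorem continuous_bandDist (t : ℕ → ℝ) (m : ℕ) : Continuous (bandDist t m) :=
  continuous_finsetSum _ fun _ _ => (continuous_tent _ _).comp continuous_abs

/-- At most two bands contain |x| or |y|. The two disjointness bounds give (difference)² ≤ 2 · 2|x -
y|². -/
theorem abs_bandDist_sub_le {t : ℕ → ℝ} (ht : Monotone t) (m : ℕ) (x y : ℝ) :
    |bandDist t m x - bandDist t m y| ≤ 2 * |x - y| := by
  have hd : ∀ z, ∀ i j : Fin m, i ≠ j → tent (t i) (t (i + 1)) z = 0 ∨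
      tent (t j) (t (j + 1)) z = 0 := fun z i j hij =>
    tent_disjoint ht (fun h => hij (Fin.ext h)) z
  have h1 := sq_sum_add_le_of_disjoint (fun i : Fin m => tent (t i) (t (i + 1)) |x|)
    (fun i => -tent (t i) (t (i + 1)) |y|) (hd _) (fun i j hij => by simpa using hd |y| i j hij)
  have h2 := sum_sq_add_le_of_disjoint (fun i : Fin m => tent (t i) (t (i + 1)) |x|)
    (fun i => -tent (t i) (t (i + 1)) |y|) |x - y| (hd _)
    (fun i j hij => by simpa using hd |y| i j hij) (fun i => by
      rw [← sub_eq_add_neg]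
      exact (abs_tent_sub_le _ _ _ _).trans (abs_abs_sub_abs_le_abs_sub _ _))
  have h3 : ∑ i : Fin m, (tent (t i) (t (i + 1)) |x| + -tent (t i) (t (i + 1)) |y|)
      = bandDist t m x - bandDist t m y := by
    simp only [← sub_eq_add_neg, Finset.sum_sub_distrib, bandDist]
  rw [h3] at h1
  refine abs_le_of_sq_le_sq (by nlinarith) (by positivity)

/-- The primitive of `bandDist`. -/
noncomputable def bandPrimitive (t : ℕ → ℝ) (m : ℕ) (x : ℝ) : ℝ := ∫ z in 0..x, bandDist t m z

theorem bandPrimitive_neg (t : ℕ → ℝ) (m : ℕ) (x : ℝ) :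
    bandPrimitive t m (-x) = -bandPrimitive t m x := by
  unfold bandPrimitive
  have h := intervalIntegral.integral_comp_neg (a := 0) (b := x) (bandDist t m)
  rw [neg_zero] at h
  rw [intervalIntegral.integral_symm, ← h]
  simp [bandDist]

theorem bandPrimitive_nonneg (t : ℕ → ℝ) (m : ℕ) {x : ℝ} (hx : 0 ≤ x) :
    0 ≤ bandPrimitive t m x :=
  intervalIntegral.integral_nonneg hx fun z _ => bandDist_nonneg t m z

theorem abs_bandPrimitive (t : ℕ → ℝ) (m : ℕ) (x : ℝ) :
    |bandPrimitive t m x| = bandPrimitive t m |x| := by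
  rcases le_total 0 x with h | h
  · rw [abs_of_nonneg h, abs_of_nonneg (bandPrimitive_nonneg t m h)]
  · have h1 := bandPrimitive_nonneg t m (neg_nonneg.2 h)
    rw [abs_of_nonpos h, bandPrimitive_neg] at *
    rw [abs_of_nonpos (by linarith)]

theorem bandPrimitive_sub (t : ℕ → ℝ) (m : ℕ) (x y : ℝ) :
    bandPrimitive t m x - bandPrimitive t m y = ∫ z in y..x, bandDist t m z :=
  intervalIntegral.integral_interval_sub_left
    ((continuous_bandDist t m).intervalIntegrable _ _)
    ((continuous_bandDist t m).intervalIntegrable _ _)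

/-- By oddness the sum is the integral of `bandDist` between -y and x, where it differs from its
value at x by at most 2|x + y|. -/
theorem abs_bandPrimitive_add_le {t : ℕ → ℝ} (ht : Monotone t) (m : ℕ) (x y : ℝ) :
    |bandPrimitive t m x + bandPrimitive t m y|
      ≤ (bandDist t m x + 2 * |x + y|) * |x + y| := by
  have h1 := bandPrimitive_sub t m x (-y)
  rw [bandPrimitive_neg, sub_neg_eq_add] at h1
  have h2 := intervalIntegral.norm_integral_le_of_norm_le_const (a := -y) (b := x)
    (f := bandDist t m) (C := bandDist t m x + 2 * |x + y|) (fun z hz => by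
      rw [Real.norm_eq_abs, abs_of_nonneg (bandDist_nonneg _ _ _)]
      have h3 := (abs_le.1 (abs_bandDist_sub_le ht m z x)).2
      have h4 : |z - x| ≤ |x + y| := by
        have := Set.abs_sub_right_of_mem_uIcc (Set.uIoc_subset_uIcc hz)
        rw [abs_sub_comm]
        simpa using this
      linarith)
  rw [h1]
  simpa using h2

/-- With y = x - t_i, on the middle half of [t_i, x] the distance to the thresholds is at least y/4,
so the integral is at least y²/8. -/
theorem sq_le_bandPrimitive_sub {t : ℕ → ℝ} {m i : ℕ} (hi : i < m) {x : ℝ} (h0 : 0 ≤ t i)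
    (h1 : t i ≤ x) (h2 : x ≤ t (i + 1)) :
    (x - t i) ^ 2 ≤ 8 * (bandPrimitive t m x - bandPrimitive t m (t i)) := by
  set y := x - t i with hy
  have hy0 : 0 ≤ y := by linarith
  rw [bandPrimitive_sub]
  have h3 : ∫ z in (t i + y / 4)..(t i + 3 * y / 4), bandDist t m z
      ≤ ∫ z in (t i)..x, bandDist t m z :=
    intervalIntegral.integral_mono_interval (by linarith) (by linarith) (by linarith)
      (Filter.Eventually.of_forall fun z => bandDist_nonneg t m z)
      ((continuous_bandDist t m).intervalIntegrable _ _)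
  have h4 : ∫ _ in (t i + y / 4)..(t i + 3 * y / 4), y / 4
      ≤ ∫ z in (t i + y / 4)..(t i + 3 * y / 4), bandDist t m z := by
    refine intervalIntegral.integral_mono_on (by linarith) intervalIntegrable_const
      ((continuous_bandDist t m).intervalIntegrable _ _) fun z hz => ?_
    have h5 : tent (t i) (t (i + 1)) |z| ≤ bandDist t m z :=
      Finset.single_le_sum (f := fun j : Fin m => tent (t j) (t (j + 1)) |z|)
        (fun j _ => tent_nonneg _ _ _) (Finset.mem_univ ⟨i, hi⟩)
    refine le_trans ?_ h5
    rw [abs_of_nonneg (by linarith [hz.1])]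
    exact le_max_of_le_right (le_min (by linarith [hz.1]) (by linarith [hz.2]))
  rw [intervalIntegral.integral_const, smul_eq_mul] at h4
  nlinarith

/-- Cauchy–Schwarz over the i bands below x, done by induction: the square of a sum of i steps is at
most i times the sum of their squares. -/
theorem sq_le_bandPrimitive {t : ℕ → ℝ} (ht : Monotone t) (h0 : t 0 = 0) {m : ℕ} (i : ℕ)
    (hi : i ≤ m) (x : ℝ) (hx0 : 0 ≤ x) (hx : x ≤ t i) :
    x ^ 2 ≤ 8 * i * bandPrimitive t m x := by
  induction i generalizing x with
  | zero =>
    have : x = 0 := le_antisymm (hx.trans h0.le) hx0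
    simp [this]
  | succ i ih =>
    have hη := bandPrimitive_nonneg t m hx0
    rcases le_total x (t i) with h | h
    · have := ih (by omega) x hx0 h
      push_cast
      linarith
    · have hti : 0 ≤ t i := h0 ▸ ht (Nat.zero_le i)
      have h1 := ih (by omega) (t i) hti le_rfl
      have h2 := sq_le_bandPrimitive_sub (m := m) (by omega) hti h hx
      have hη' := bandPrimitive_nonneg t m hti
      push_cast
      rcases Nat.eq_zero_or_pos i with rfl | hi0
      · rw [h0] at h2
        simp only [sub_zero] at h2
        rw [h0] at hη'
        simp only [Nat.cast_zero]
        linarith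
      · have hi1 : (0 : ℝ) < i := by exact_mod_cast hi0
        set a := t i
        set b := x - a
        set A := bandPrimitive t m a
        set B := bandPrimitive t m x
        have hx' : x = a + b := by ring
        have h3 : i * (a + b) ^ 2 ≤ (i + 1) * (a ^ 2 + i * b ^ 2) := by
          nlinarith [sq_nonneg (a - i * b)]
        have h4 : a ^ 2 + i * b ^ 2 ≤ i * (8 * B) := by nlinarith
        rw [hx']
        refine le_of_mul_le_mul_left ?_ hi1
        nlinarith

/-- Greedy choice: by the intermediate value theorem the next threshold is where the error of the
band reaches ε, or M if it never exceeds ε. -/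
theorem exists_thresholds (e : ℝ → ℝ → ℝ) (he : ∀ s, Continuous (e s)) (h0 : ∀ s, e s s = 0)
    {M ε : ℝ} (hM : 0 ≤ M) (hε : 0 < ε) :
    ∃ t : ℕ → ℝ, t 0 = 0 ∧ Monotone t ∧ (∀ i, t i ≤ M) ∧ ∀ i, e (t i) (t (i + 1)) ≤ ε ∧
      (t (i + 1) = M ∨ e (t i) (t (i + 1)) = ε) := by
  have step : ∀ s, s ≤ M → ∃ t, s ≤ t ∧ t ≤ M ∧ e s t ≤ ε ∧ (t = M ∨ e s t = ε) := by
    intro s hs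
    by_cases h : e s M ≤ ε
    · exact ⟨M, hs, le_rfl, h, Or.inl rfl⟩
    · obtain ⟨t, ht, hte⟩ := intermediate_value_Icc hs (he s).continuousOn
        (show ε ∈ Set.Icc (e s s) (e s M) from ⟨by rw [h0]; exact hε.le, (not_le.1 h).le⟩)
      exact ⟨t, ht.1, ht.2, hte.le, Or.inr hte⟩
  choose! f hf using step
  let t : ℕ → ℝ := fun n => Nat.rec 0 (fun _ s => f s) n
  have hM' : ∀ i, t i ≤ M := by
    intro i
    induction i with
    | zero => exact hM
    | succ i ih => exact (hf _ ih).2.1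
  exact ⟨t, rfl, monotone_nat_of_le_succ fun i => (hf _ (hM' i)).1, hM',
    fun i => (hf _ (hM' i)).2.2⟩

end Tent

/-! ### The improved dual Cheeger inequality for one function. -/

section ImprovedCheeger

variable {V : Type*} [Fintype V] (G : WeightedGraph V)

/-- An edge meets at most two bands, and each changes by at most 2|f(u) + f(v)|: the factor is 2 ·
2² = 8. -/
theorem sum_signlessEnergy_oddTent_le {t : ℕ → ℝ} (h0 : t 0 = 0) (ht : Monotone t) (m : ℕ)
    (f : V → ℝ) :
    ∑ i : Fin m, G.signlessEnergy (fun u => oddTent (t i) (t (i + 1)) (f u))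
      ≤ 8 * G.signlessEnergy f := by
  have hti : ∀ i, 0 ≤ t i := fun i => h0 ▸ ht (Nat.zero_le i)
  have hd : ∀ x, ∀ i j : Fin m, i ≠ j → oddTent (t i) (t (i + 1)) x = 0 ∨
      oddTent (t j) (t (j + 1)) x = 0 := by
    intro x i j hij
    refine (tent_disjoint ht (fun h => hij (Fin.ext h)) |x|).imp (fun h => ?_) (fun h => ?_)
    · have := oddTent_sq (hti i) (t (i + 1)) x
      rw [h] at this
      simpa using this
    · have := oddTent_sq (hti j) (t (j + 1)) x
      rw [h] at this
      simpa using this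
  unfold signlessEnergy
  rw [← Finset.mul_sum, mul_left_comm]
  refine mul_le_mul_of_nonneg_left ?_ (by norm_num)
  rw [Finset.sum_comm, Finset.mul_sum]
  refine Finset.sum_le_sum fun u _ => ?_
  rw [Finset.sum_comm, Finset.mul_sum]
  refine Finset.sum_le_sum fun v _ => ?_
  rw [← Finset.mul_sum]
  have h := sum_sq_add_le_of_disjoint (fun i : Fin m => oddTent (t i) (t (i + 1)) (f u))
    (fun i : Fin m => oddTent (t i) (t (i + 1)) (f v)) (2 * |f u + f v|) (hd _) (hd _)
    (fun i => abs_oddTent_add_le _ _ _ _)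
  rw [mul_pow, sq_abs] at h
  nlinarith [mul_le_mul_of_nonneg_left h (G.w_nonneg u v)]

theorem sqNorm_oddTent {s : ℝ} (hs : 0 ≤ s) (t : ℝ) (f : V → ℝ) :
    G.sqNorm (fun u => oddTent s t (f u)) = G.sqNorm (fun u => tent s t |f u|) :=
  Finset.sum_congr rfl fun u _ => by rw [oddTent_sq hs]

/-- A function is close to a step function with few steps. -/
theorem exists_thresholds_bandDist {l : ℕ} (hl : 1 ≤ l) (hlN : l ≤ Fintype.card V)
    (hδ : 0 < G.topGap l) (f : V → ℝ) (hE : 0 < G.signlessEnergy f) {M : ℝ} (hM : 0 ≤ M) :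
    ∃ t : ℕ → ℝ, t 0 = 0 ∧ Monotone t ∧ t (2 * l) = M ∧
      G.sqNorm (fun u => bandDist t (2 * l) (f u)) ≤ 64 * G.signlessEnergy f / G.topGap l := by
  have hl0 : (0 : ℝ) < l := by exact_mod_cast hl
  set ε := 32 * G.signlessEnergy f / (l * G.topGap l) with hε
  have hε0 : 0 < ε := by positivity
  obtain ⟨t, h0, ht, htM, hte⟩ := exists_thresholds
    (fun s t => G.sqNorm (fun u => tent s t |f u|))
    (fun s => by
      unfold sqNorm
      exact continuous_finsetSum _ fun u _ =>
        continuous_const.mul ((continuous_tent_right s |f u|).pow 2))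
    (fun s => by simp [sqNorm, tent_self]) hM hε0
  have hti : ∀ i, 0 ≤ t i := fun i => h0 ▸ ht (Nat.zero_le i)
  refine ⟨t, h0, ht, ?_, ?_⟩
  -- Otherwise all 2l tents have squared norm exactly ε. Their energies total at most 8E, so at
  -- least l of them have energy ≤ 8E/l = (δ/4)ε with δ = `topGap l`, which forces δ ≤ δ/2.
  · by_contra hne
    have heq : ∀ i : Fin (2 * l), G.sqNorm (fun u => oddTent (t i) (t (i + 1)) (f u)) = ε := by
      intro i
      rw [G.sqNorm_oddTent (hti i)]
      refine (hte i).2.resolve_left fun h => hne (le_antisymm (htM _) ?_)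
      rw [← h]
      exact ht (by omega)
    let g : Fin (2 * l) → V → ℝ := fun i u => oddTent (t i) (t (i + 1)) (f u)
    have hsum : ∑ i, G.signlessEnergy (g i) ≤ 8 * G.signlessEnergy f :=
      G.sum_signlessEnergy_oddTent_le h0 ht _ f
    set B := Finset.univ.filter fun i => ¬ (G.signlessEnergy (g i) ≤ 8 * G.signlessEnergy f / l)
    have hB : B.card ≤ l := by
      have h1 : B.card • (8 * G.signlessEnergy f / l) ≤ ∑ i ∈ B, G.signlessEnergy (g i) :=
        Finset.card_nsmul_le_sum _ _ _ fun i hi => (not_le.1 (Finset.mem_filter.1 hi).2).le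
      have h2 : ∑ i ∈ B, G.signlessEnergy (g i) ≤ ∑ i, G.signlessEnergy (g i) :=
        Finset.sum_le_univ_sum_of_nonneg fun i => G.signlessEnergy_nonneg _
      have h3 := (h1.trans h2).trans hsum
      rw [nsmul_eq_mul, mul_div_assoc', div_le_iff₀ hl0, mul_comm] at h3
      exact_mod_cast le_of_mul_le_mul_left h3 (by positivity)
    have hcard : l ≤ Fintype.card
        {i : Fin (2 * l) // G.signlessEnergy (g i) ≤ 8 * G.signlessEnergy f / l} := by
      have h1 := Finset.card_filter_add_card_filter_not (s := (Finset.univ : Finset (Fin (2 * l))))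
        (fun i => G.signlessEnergy (g i) ≤ 8 * G.signlessEnergy f / l)
      rw [Finset.card_univ, Fintype.card_fin] at h1
      rw [Fintype.card_subtype]
      change _ + B.card = _ at h1
      omega
    have h := G.topGap_le_of_disjoint hl hlN hcard (fun i => g i.1)
      (fun i j hij u => by
        refine (tent_disjoint ht (fun h => hij (Subtype.ext (Fin.ext h))) |f u|).imp
          (fun h => ?_) (fun h => ?_)
        · have := oddTent_sq (hti i.1) (t (i.1 + 1)) (f u)
          rw [h] at this
          simpa [g] using this
        · have := oddTent_sq (hti j.1) (t (j.1 + 1)) (f u)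
          rw [h] at this
          simpa [g] using this)
      (fun i => by rw [heq i.1]; exact hε0) (G.topGap l / 4) (fun i => by
        rw [heq i.1]
        refine i.2.trans (le_of_eq ?_)
        rw [hε]; field_simp; norm_num)
    linarith
  · have h1 := G.sqNorm_sum_of_disjoint (fun (i : Fin (2 * l)) u => tent (t i) (t (i + 1)) |f u|)
      (fun _ => 1) (fun i j hij u => tent_disjoint ht (fun h => hij (Fin.ext h)) _)
    simp only [one_mul, one_pow] at h1
    unfold bandDist
    rw [h1]
    refine (Finset.sum_le_sum fun i _ => (hte i.1).1).trans (le_of_eq ?_)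
    rw [Finset.sum_const, Finset.card_univ, Fintype.card_fin, nsmul_eq_mul, hε]
    push_cast
    field_simp; norm_num

variable [DecidableEq V]

/-- Zero energy means f(u) = -f(v) along every edge, so the l¹ energy vanishes too and the coarea
bound applies with c = 0. -/
theorem exists_dualExpansion_eq_one (f : V → ℝ) (hf : f ≠ 0) (hE : G.signlessEnergy f = 0) :
    ∃ S T : Finset V, (∀ u ∈ S, 0 < f u) ∧ (∀ u ∈ T, f u < 0) ∧ S ∪ T ≠ ∅ ∧
      1 - G.dualExpansion S T ≤ 0 := by
  refine G.exists_one_sub_dualExpansion_le 0 f hf ?_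
  have h1 : ∑ u, ∑ v, G.w u v * (f u + f v) ^ 2 = 0 := by
    unfold signlessEnergy at hE; linarith
  have h2 : ∀ u v, 0 ≤ G.w u v * (f u + f v) ^ 2 := fun u v =>
    mul_nonneg (G.w_nonneg u v) (sq_nonneg _)
  rw [zero_mul]
  refine le_of_eq ?_
  rw [mul_eq_zero]
  refine Or.inr (Finset.sum_eq_zero fun u hu => Finset.sum_eq_zero fun v hv => ?_)
  have h3 := (Finset.sum_eq_zero_iff_of_nonneg
    (fun v _ => h2 u v)).1 ((Finset.sum_eq_zero_iff_of_nonneg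
      (fun u _ => Finset.sum_nonneg fun v _ => h2 u v)).1 h1 u hu) v hv
  rcases mul_eq_zero.1 h3 with h | h
  · rw [h, zero_mul]
  · rw [pow_eq_zero_iff two_ne_zero] at h
    rw [h, abs_zero, mul_zero]

/-- The improved dual Cheeger inequality for a single function. -/
theorem exists_dualExpansion_of_signlessEnergy {l : ℕ} (hl : 1 ≤ l) (hlN : l ≤ Fintype.card V)
    (hδ : 0 < G.topGap l) (f : V → ℝ) (hf : 0 < G.sqNorm f) :
    ∃ S T : Finset V, (∀ u ∈ S, 0 < f u) ∧ (∀ u ∈ T, f u < 0) ∧ S ∪ T ≠ ∅ ∧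
      1 - G.dualExpansion S T
        ≤ 144 * l * (G.signlessEnergy f / G.sqNorm f / √(G.topGap l)) := by
  have hf0 : f ≠ 0 := by
    rintro rfl
    simp [sqNorm] at hf
  rcases (G.signlessEnergy_nonneg f).eq_or_lt with hE | hE
  · rw [← hE]
    simpa using G.exists_dualExpansion_eq_one f hf0 hE.symm
  have hl0 : (0 : ℝ) < l := by exact_mod_cast hl
  obtain ⟨u0, hu0⟩ := Function.ne_iff.1 hf0
  obtain ⟨u1, -, hu1⟩ := Finset.exists_max_image Finset.univ (fun u => |f u|) ⟨u0, by simp⟩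
  obtain ⟨t, h0, ht, htM, hψ⟩ := G.exists_thresholds_bandDist hl hlN hδ f hE (abs_nonneg (f u1))
  set η := bandPrimitive t (2 * l) with hη
  set ψ := bandDist t (2 * l) with hψdef
  set δ := G.topGap l
  set E := G.signlessEnergy f with hEdef
  have hs : 0 < √δ := Real.sqrt_pos.2 hδ
  have hss : √δ * √δ = δ := Real.mul_self_sqrt hδ.le
  have hs2 : √δ ≤ 3 / 2 := by
    rw [Real.sqrt_le_left (by norm_num)]
    have := G.topGap_le_two hl hlN
    change δ ≤ 2 at this
    linarith
  have hlow : G.sqNorm f ≤ 16 * l * ∑ u, G.deg u * |η (f u)| := by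
    unfold sqNorm
    rw [Finset.mul_sum]
    refine Finset.sum_le_sum fun u _ => ?_
    have h1 := sq_le_bandPrimitive ht h0 (2 * l) le_rfl |f u| (abs_nonneg _)
      (by rw [htM]; exact hu1 u (Finset.mem_univ u))
    rw [sq_abs] at h1
    rw [hη, abs_bandPrimitive]
    push_cast at h1
    nlinarith [mul_le_mul_of_nonneg_left h1 (G.deg_pos u).le]
  -- Weighted AM–GM: √δ balances the energy term against the band error 64E/δ. The total is at most
  -- (4 + 6 + 8)E/√δ before halving, using √δ ≤ 3/2. With the 16l of `hlow` this gives 144l.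
  have hup : 1 / 2 * ∑ u, ∑ v, G.w u v * |η (f u) + η (f v)| ≤ 9 * E / √δ := by
    have h1 : ∀ u v, G.w u v * |η (f u) + η (f v)| ≤
        (2 / √δ + 2) * (G.w u v * (f u + f v) ^ 2) + √δ / 8 * (G.w u v * ψ (f u) ^ 2) := by
      intro u v
      have h2 := abs_bandPrimitive_add_le ht (2 * l) (f u) (f v)
      have h3 : |f u + f v| * ψ (f u) ≤ 2 / √δ * (f u + f v) ^ 2 + √δ / 8 * ψ (f u) ^ 2 := by
        rw [← sq_abs (f u + f v)]
        have h4 : 2 / √δ * |f u + f v| ^ 2 + √δ / 8 * ψ (f u) ^ 2 - |f u + f v| * ψ (f u)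
            = 2 / √δ * (|f u + f v| - √δ / 4 * ψ (f u)) ^ 2 := by
          field_simp; ring
        have h5 : 0 ≤ 2 / √δ * (|f u + f v| - √δ / 4 * ψ (f u)) ^ 2 := by positivity
        linarith
      have h6 : |η (f u) + η (f v)|
          ≤ (2 / √δ + 2) * (f u + f v) ^ 2 + √δ / 8 * ψ (f u) ^ 2 := by
        refine h2.trans ?_
        have : 2 * |f u + f v| * |f u + f v| = 2 * (f u + f v) ^ 2 := by
          rw [← sq_abs (f u + f v)]; ring
        rw [add_mul, add_mul, this]
        linarith
      refine (mul_le_mul_of_nonneg_left h6 (G.w_nonneg u v)).trans (le_of_eq (by ring))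
    have h2 := Finset.sum_le_sum fun u (_ : u ∈ Finset.univ) =>
      Finset.sum_le_sum fun v (_ : v ∈ Finset.univ) => h1 u v
    simp only [Finset.sum_add_distrib, ← Finset.mul_sum] at h2
    have h3 := G.sum_w_fst (fun u => ψ (f u) ^ 2)
    rw [h3] at h2
    have h4 : ∑ u, ∑ v, G.w u v * (f u + f v) ^ 2 = 2 * E := by
      rw [hEdef]; unfold signlessEnergy; ring
    rw [h4] at h2
    have h5 : √δ / 8 * ∑ u, G.deg u * ψ (f u) ^ 2 ≤ √δ / 8 * (64 * E / δ) :=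
      mul_le_mul_of_nonneg_left hψ (by positivity)
    have h6 : √δ / 8 * (64 * E / δ) = 8 * (E / √δ) := by
      rw [← hss]; field_simp; norm_num
    have h7 : (2 / √δ + 2) * (2 * E) ≤ 10 * (E / √δ) := by
      have : E ≤ 3 / 2 * (E / √δ) := by
        rw [mul_div_assoc', le_div_iff₀ hs]; nlinarith
      calc (2 / √δ + 2) * (2 * E) = 4 * (E / √δ) + 4 * E := by ring
        _ ≤ _ := by linarith
    have h8 : 9 * E / √δ = 9 * (E / √δ) := mul_div_assoc _ _ _
    rw [h8]
    linarith
  have hη0 : (fun u => η (f u)) ≠ 0 := by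
    intro h
    have h1 : ∀ u, η (f u) = 0 := fun u => congrFun h u
    simp only [h1, abs_zero, mul_zero, Finset.sum_const_zero] at hlow
    linarith
  obtain ⟨S, T, hS, hT, hST, hle⟩ := G.exists_one_sub_dualExpansion_le
    (144 * l * (E / G.sqNorm f / √δ)) (fun u => η (f u)) hη0 (by
      refine hup.trans ?_
      have h1 : 144 * l * (E / G.sqNorm f / √δ) * ∑ u, G.deg u * |η (f u)|
          = 9 * E / √δ * ((16 * l * ∑ u, G.deg u * |η (f u)|) / G.sqNorm f) := by
        field_simp; ring
      rw [h1]
      refine le_mul_of_one_le_right (by positivity) ?_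
      rwa [one_le_div hf])
  refine ⟨S, T, fun u hu => ?_, fun u hu => ?_, hST, hle⟩
  · by_contra h
    have h1 := bandPrimitive_nonneg t (2 * l) (neg_nonneg.2 (not_lt.1 h))
    rw [bandPrimitive_neg] at h1
    have h2 := hS u hu
    change 0 < bandPrimitive t (2 * l) (f u) at h2
    linarith
  · by_contra h
    exact absurd (hT u hu) (not_lt.2 (bandPrimitive_nonneg t (2 * l) (not_lt.1 h)))

end ImprovedCheeger

/-! ### Staircases: a deterministic substitute for randomly shifted grids. -/

section Stair

/-- A staircase of slope `1` on the slots `[n q + i, n q + i + 1]` and constant elsewhere. -/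
noncomputable def stair (n i : ℕ) (s : ℝ) : ℝ :=
  ⌊s / n⌋ + max 0 (min 1 (s - n * ⌊s / n⌋ - i))

theorem stair_zero (n i : ℕ) : stair n i 0 = 0 := by
  simp [stair]

theorem stair_mono {n : ℕ} (hn : 0 < n) (i : ℕ) : Monotone (stair n i) := by
  intro s t hst
  have hn' : (0 : ℝ) < n := by exact_mod_cast hn
  have hq : ⌊s / n⌋ ≤ ⌊t / n⌋ := Int.floor_mono (by gcongr)
  unfold stair
  rcases hq.eq_or_lt with h | h
  · rw [h]
    gcongr
  · have h1 : ((⌊s / n⌋ : ℤ) : ℝ) + 1 ≤ (⌊t / n⌋ : ℤ) := by exact_mod_cast h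
    have h2 : max 0 (min 1 (s - n * ⌊s / n⌋ - i)) ≤ 1 := max_le zero_le_one (min_le_left _ _)
    have h3 : 0 ≤ max 0 (min 1 (t - n * ⌊t / n⌋ - i)) := le_max_left _ _
    linarith

theorem abs_stair_sub_le (n i : ℕ) (s : ℝ) : |stair n i s - s / n| ≤ 1 := by
  unfold stair
  have h2 : max 0 (min 1 (s - n * ⌊s / n⌋ - i)) ≤ 1 := max_le zero_le_one (min_le_left _ _)
  have h3 : 0 ≤ max 0 (min 1 (s - n * ⌊s / n⌋ - i)) := le_max_left _ _
  have h4 := Int.floor_le (s / n)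
  have h5 := Int.lt_floor_add_one (s / n)
  rw [abs_le]
  constructor <;> linarith

theorem sum_clamp (n : ℕ) (r : ℝ) :
    ∑ i ∈ Finset.range n, max 0 (min 1 (r - i)) = max 0 (min (n : ℝ) r) := by
  induction n with
  | zero =>
    simp
  | succ n ih =>
    rw [Finset.sum_range_succ, ih]
    have hn : (0 : ℝ) ≤ n := n.cast_nonneg
    push_cast
    rcases le_total r n with h | h
    · rw [min_eq_right h, min_eq_right (by linarith), min_eq_right (by linarith),
        max_eq_left (a := (0 : ℝ)) (b := r - n) (by linarith), add_zero]
    · rw [min_eq_left h, max_eq_right hn]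
      rcases le_total r (n + 1) with h' | h'
      · rw [min_eq_right (by linarith), min_eq_right h', max_eq_right (by linarith),
          max_eq_right (by linarith)]
        ring
      · rw [min_eq_left (by linarith), min_eq_left h', max_eq_right (by linarith),
          max_eq_right (by linarith)]

/-- The slots of the n staircases tile the line, so at each point exactly one of them climbs. -/
theorem sum_stair {n : ℕ} (hn : 0 < n) (s : ℝ) : ∑ i : Fin n, stair n i s = s := by
  have hn' : (0 : ℝ) < n := by exact_mod_cast hn
  have h4 := Int.floor_le (s / n)
  have h5 := Int.lt_floor_add_one (s / n)
  rw [le_div_iff₀ hn'] at h4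
  rw [div_lt_iff₀ hn'] at h5
  rw [Fin.sum_univ_eq_sum_range (fun i => stair n i s)]
  unfold stair
  rw [Finset.sum_add_distrib, sum_clamp, Finset.sum_const, Finset.card_range, nsmul_eq_mul,
    min_eq_right (by linarith), max_eq_right (by linarith)]
  ring

/-- Outside its slots a staircase is integral, and s lies in the slots of only one i. So the average
distance to the integers is at most 1/n. -/
theorem sum_abs_stair_sub_round_le (n : ℕ) (s : ℝ) :
    ∑ i : Fin n, |stair n i s - round (stair n i s)| ≤ 1 := by
  classical
  set r := s - n * ⌊s / n⌋ with hr
  have h1 : ∀ i : Fin n, ⌊r⌋ ≠ i → stair n i s - round (stair n i s) = 0 := by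
    intro i hi
    have h2 : ∃ z : ℤ, stair n i s = z := by
      unfold stair
      rw [← hr]
      rcases le_or_gt r i with h | h
      · exact ⟨⌊s / n⌋, by rw [max_eq_left ((min_le_right _ _).trans (by linarith)), add_zero]⟩
      · have h3 : ((i : ℕ) : ℝ) + 1 ≤ r := by
          by_contra h4
          refine hi (Int.floor_eq_iff.2 ?_)
          push_cast
          exact ⟨h.le, not_le.1 h4⟩
        refine ⟨⌊s / n⌋ + 1, ?_⟩
        rw [min_eq_left (by linarith), max_eq_right zero_le_one]
        push_cast; rfl
    obtain ⟨z, hz⟩ := h2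
    rw [hz]
    simp
  have h2 : ∀ i : Fin n, |stair n i s - round (stair n i s)|
      ≤ if ⌊r⌋ = (i : ℕ) then 1 else 0 := by
    intro i
    split_ifs with h
    · exact (abs_sub_round _).trans (by norm_num)
    · rw [h1 i h, abs_zero]
  refine (Finset.sum_le_sum fun i _ => h2 i).trans ?_
  rw [← Finset.sum_filter, Finset.sum_const, nsmul_eq_mul, mul_one]
  norm_cast
  rw [Finset.card_le_one]
  intro i hi j hj
  simp only [Finset.mem_filter, Finset.mem_univ, true_and] at hi hj
  exact Fin.ext (by exact_mod_cast hi.symm.trans hj)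

/-- The odd version of the staircase. -/
noncomputable def oddStair (n i : ℕ) (s : ℝ) : ℝ := stair n i (max s 0) - stair n i (max (-s) 0)

theorem oddStair_neg (n i : ℕ) (s : ℝ) : oddStair n i (-s) = -oddStair n i s := by
  simp [oddStair]

theorem oddStair_of_nonneg (n i : ℕ) {s : ℝ} (hs : 0 ≤ s) : oddStair n i s = stair n i s := by
  rw [oddStair, max_eq_left hs, max_eq_right (by linarith), stair_zero, sub_zero]

theorem oddStair_mono {n : ℕ} (hn : 0 < n) (i : ℕ) : Monotone (oddStair n i) := by
  intro s t hst
  exact sub_le_sub (stair_mono hn i (max_le_max_right _ hst))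
    (stair_mono hn i (max_le_max_right _ (neg_le_neg hst)))

theorem abs_oddStair_sub_le (n i : ℕ) (s : ℝ) : |oddStair n i s - s / n| ≤ 1 := by
  rcases le_total 0 s with h | h
  · rw [oddStair_of_nonneg n i h]
    exact abs_stair_sub_le n i s
  · have h1 := abs_stair_sub_le n i (-s)
    rw [← oddStair_of_nonneg n i (neg_nonneg.2 h), oddStair_neg] at h1
    rwa [neg_div, sub_neg_eq_add, neg_add_eq_sub, abs_sub_comm] at h1

theorem sum_oddStair {n : ℕ} (hn : 0 < n) (s : ℝ) : ∑ i : Fin n, oddStair n i s = s := by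
  unfold oddStair
  rw [Finset.sum_sub_distrib, sum_stair hn, sum_stair hn]
  rcases le_total 0 s with h | h
  · rw [max_eq_left h, max_eq_right (by linarith), sub_zero]
  · rw [max_eq_right h, max_eq_left (by linarith)]; ring

/-- Odd and monotone: all terms have the sign of s + t, and they sum to s + t. -/
theorem sum_sq_oddStair_add_le {n : ℕ} (hn : 0 < n) (s t : ℝ) :
    ∑ i : Fin n, (oddStair n i s + oddStair n i t) ^ 2 ≤ (s + t) ^ 2 := by
  have h1 : ∑ i : Fin n, (oddStair n i s + oddStair n i t) = s + t := by
    rw [Finset.sum_add_distrib, sum_oddStair hn, sum_oddStair hn]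
  rcases le_total (-t) s with h | h
  · rw [← h1]
    refine Finset.sum_sq_le_sq_sum_of_nonneg (fun i _ => ?_)
    have := oddStair_mono hn i h
    rw [oddStair_neg] at this
    linarith
  · rw [← h1, ← neg_sq (∑ i : Fin n, _), ← Finset.sum_neg_distrib]
    simp only [← neg_sq (oddStair n _ s + oddStair n _ t)]
    refine Finset.sum_sq_le_sq_sum_of_nonneg (fun i _ => ?_)
    have := oddStair_mono hn i h
    rw [oddStair_neg] at this
    linarith

theorem abs_sub_round_neg (x : ℝ) : |-x - round (-x)| = |x - round x| := by
  refine le_antisymm ?_ ?_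
  · have := round_le (-x) (-round x)
    push_cast at this
    rwa [sub_neg_eq_add, neg_add_eq_sub, abs_sub_comm _ x] at this
  · have := round_le x (-round (-x))
    push_cast at this
    rwa [sub_neg_eq_add, ← abs_neg (x + _), neg_add] at this

theorem sum_abs_oddStair_sub_round_le (n : ℕ) (s : ℝ) :
    ∑ i : Fin n, |oddStair n i s - round (oddStair n i s)| ≤ 1 := by
  rcases le_total 0 s with h | h
  · simp only [oddStair_of_nonneg n _ h]
    exact sum_abs_stair_sub_round_le n s
  · simp only [← abs_sub_round_neg (oddStair n _ s), ← oddStair_neg]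
    simp only [oddStair_of_nonneg n _ (neg_nonneg.2 h)]
    exact sum_abs_stair_sub_round_le n (-s)

end Stair

/-! ### Cut-off functions on antipodal pairs of grid cells. -/

section Bump

variable {k : ℕ}

/-- The cell of `p` in the grid, up to the antipodal map. -/
noncomputable def cellKey (p : Fin k → ℝ) : Sym2 (Fin k → ℤ) :=
  s(fun j => round (p j), fun j => -round (p j))

/-- The sup-distance of `p` to the boundary of its cell, normalized to have values in `[0, 1]`. -/
noncomputable def bump (p : Fin k → ℝ) : ℝ := 1 - 2 * ‖fun j => p j - round (p j)‖

theorem bump_le_one (p : Fin k → ℝ) : bump p ≤ 1 := by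
  have := norm_nonneg fun j => p j - round (p j)
  unfold bump
  linarith

theorem bump_nonneg (p : Fin k → ℝ) : 0 ≤ bump p := by
  have : ‖fun j => p j - round (p j)‖ ≤ 1 / 2 :=
    (pi_norm_le_iff_of_nonneg (by norm_num)).2 fun j => abs_sub_round _
  unfold bump
  linarith

theorem bump_sub_bump_le (p q : Fin k → ℝ) : bump p - bump q ≤ 2 * ‖p + q‖ := by
  have h : ‖fun j => q j - round (q j)‖ ≤ ‖p + q‖ + ‖fun j => p j - round (p j)‖ := by
    refine (pi_norm_le_iff_of_nonneg (by positivity)).2 fun j => ?_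
    have h1 := round_le (q j) (-round (p j))
    push_cast at h1
    have h2 := norm_le_pi_norm (p + q) j
    have h3 := norm_le_pi_norm (fun j => p j - round (p j)) j
    rw [Real.norm_eq_abs] at h2 h3 ⊢
    have h4 : q j - -(round (p j) : ℝ) = (p + q) j - (p j - round (p j)) := by
      simp only [Pi.add_apply]; ring
    rw [h4] at h1
    exact h1.trans ((abs_sub _ _).trans (add_le_add h2 h3))
  unfold bump
  linarith

/-- If -q is closer to p than the boundary of the cell of p, then -q lies in that cell and the keys
agree. -/
theorem bump_le_of_cellKey_ne {p q : Fin k → ℝ} (h : cellKey p ≠ cellKey q) :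
    bump p ≤ 2 * ‖p + q‖ := by
  by_contra hlt
  rw [not_le] at hlt
  unfold bump at hlt
  refine h ?_
  have h1 : ∀ j, round (q j) = -round (p j) := by
    intro j
    have h2 := norm_le_pi_norm (p + q) j
    have h3 := norm_le_pi_norm (fun j => p j - round (p j)) j
    rw [Real.norm_eq_abs, abs_le] at h2 h3
    simp only [Pi.add_apply] at h2
    rw [round_eq, Int.floor_eq_iff]
    push_cast
    constructor <;> linarith
  unfold cellKey
  simp only [h1, neg_neg]
  exact Sym2.eq_swap

theorem cellKey_eq {p q : Fin k → ℝ} (h : cellKey p = cellKey q) :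
    (∀ j, |p j - q j| ≤ 1) ∨ ∀ j, |p j + q j| ≤ 1 := by
  rw [cellKey, cellKey, Sym2.eq_iff] at h
  refine h.imp (fun h j => ?_) (fun h j => ?_)
  · have h1 : ((round (p j) : ℤ) : ℝ) = round (q j) := by rw [congrFun h.1 j]
    have h2 := abs_le.1 (abs_sub_round (p j))
    have h3 := abs_le.1 (abs_sub_round (q j))
    rw [abs_le]
    constructor <;> linarith
  · have h1 : ((round (p j) : ℤ) : ℝ) = -round (q j) := by exact_mod_cast congrFun h.1 j
    have h2 := abs_le.1 (abs_sub_round (p j))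
    have h3 := abs_le.1 (abs_sub_round (q j))
    rw [abs_le]
    constructor <;> linarith

open Classical in
/-- The bump function restricted to a family of cells. -/
noncomputable def cellBump (J : Finset (Sym2 (Fin k → ℤ))) (p : Fin k → ℝ) : ℝ :=
  if cellKey p ∈ J then bump p else 0

/-- The control is by p + q, not p - q: small signless energy puts the ends of an edge at nearly
antipodal points. Between distinct keys the cut-off vanishes at the cell boundary. -/
theorem abs_cellBump_sub_le (J : Finset (Sym2 (Fin k → ℤ))) (p q : Fin k → ℝ) :
    |cellBump J p - cellBump J q| ≤ 2 * ‖p + q‖ := by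
  have h1 := bump_sub_bump_le p q
  have h2 := bump_sub_bump_le q p
  have h3 := bump_nonneg p
  have h4 := bump_nonneg q
  rw [add_comm] at h2
  unfold cellBump
  by_cases hp : cellKey p ∈ J <;> by_cases hq : cellKey q ∈ J
  · simp only [hp, hq, if_true]
    rw [abs_le]
    constructor <;> linarith
  · simp only [hp, hq, if_true, if_false, sub_zero]
    rw [abs_of_nonneg h3]
    exact bump_le_of_cellKey_ne fun h => hq (h ▸ hp)
  · simp only [hp, hq, if_true, if_false, zero_sub, abs_neg]
    rw [abs_of_nonneg h4, add_comm]
    exact bump_le_of_cellKey_ne fun h => hp (h ▸ hq)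
  · simp [hp, hq]

theorem pi_norm_sq_le (p : Fin k → ℝ) : ‖p‖ ^ 2 ≤ ∑ j, p j ^ 2 := by
  have h0 : 0 ≤ ∑ j, p j ^ 2 := Finset.sum_nonneg fun j _ => sq_nonneg _
  rw [← Real.le_sqrt (norm_nonneg _) h0, pi_norm_le_iff_of_nonneg (Real.sqrt_nonneg _)]
  intro j
  rw [Real.norm_eq_abs]
  exact Real.abs_le_sqrt (Finset.single_le_sum (f := fun j => p j ^ 2)
    (fun j _ => sq_nonneg _) (Finset.mem_univ j))

theorem sq_cellBump_sub_le (J : Finset (Sym2 (Fin k → ℤ))) (p q : Fin k → ℝ) :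
    (cellBump J p - cellBump J q) ^ 2 ≤ 4 * ∑ j, (p j + q j) ^ 2 := by
  have h1 := abs_cellBump_sub_le J p q
  have h2 := pi_norm_sq_le (p + q)
  simp only [Pi.add_apply] at h2
  rw [← sq_abs]
  nlinarith [abs_nonneg (cellBump J p - cellBump J q), norm_nonneg (p + q)]

theorem one_sub_bump_sq_le (p : Fin k → ℝ) :
    1 - bump p ^ 2 ≤ 4 * ∑ j, |p j - round (p j)| := by
  have h0 : ∀ j, 0 ≤ |p j - round (p j)| := fun j => abs_nonneg _
  have h1 : ‖fun j => p j - round (p j)‖ ≤ ∑ j, |p j - round (p j)| :=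
    (pi_norm_le_iff_of_nonneg (Finset.sum_nonneg fun j _ => h0 j)).2 fun j =>
      Finset.single_le_sum (f := fun j => |p j - round (p j)|) (fun j _ => h0 j)
        (Finset.mem_univ j)
  have h2 := bump_nonneg p
  have h3 := bump_le_one p
  have h4 : 1 - bump p = 2 * ‖fun j => p j - round (p j)‖ := by unfold bump; ring
  nlinarith

end Bump

/-! ### Averaging and greedy grouping. -/

section Averaging

/-- If every i fails, then L/A + D/B > 2 for each i, contradicting the averages. For B = 0 every D
vanishes, so every L would exceed 2A. -/
theorem exists_le_two_mul_average {n : ℕ} (hn : 0 < n) (L D : Fin n → ℝ) (hD : ∀ i, 0 ≤ D i)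
    {A B : ℝ} (hA : 0 < A) (hL : ∀ i, 0 ≤ L i) (hLA : ∑ i, L i ≤ n * A)
    (hDB : ∑ i, D i ≤ n * B) : ∃ i, L i ≤ 2 * A ∧ D i ≤ 2 * B := by
  by_contra! h
  have hn' : (0 : ℝ) < n := by exact_mod_cast hn
  have hB : 0 ≤ B := by
    have := (Finset.sum_nonneg fun i (_ : i ∈ Finset.univ) => hD i).trans hDB
    exact nonneg_of_mul_nonneg_right this hn'
  have hne : (Finset.univ : Finset (Fin n)).Nonempty := ⟨⟨0, hn⟩, Finset.mem_univ _⟩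
  rcases hB.eq_or_lt with hB | hB
  · have h1 : ∀ i, D i ≤ 0 := fun i => by
      have := Finset.single_le_sum (fun i _ => hD i) (Finset.mem_univ i)
      rw [← hB, mul_zero] at hDB
      exact this.trans hDB
    have h2 : ∀ i, 2 * A < L i := fun i => by
      by_contra h3
      have := h i (not_lt.1 h3)
      rw [← hB] at this
      linarith [h1 i]
    have h3 := Finset.sum_lt_sum_of_nonempty hne fun i _ => h2 i
    simp only [Finset.sum_const, Finset.card_univ, Fintype.card_fin, nsmul_eq_mul] at h3
    nlinarith
  · have h1 : ∀ i, 2 * (A * B) < B * L i + A * D i := fun i => by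
      by_cases h2 : L i ≤ 2 * A
      · have := mul_lt_mul_of_pos_left (h i h2) hA
        nlinarith [mul_nonneg hB.le (hL i)]
      · have := mul_lt_mul_of_pos_left (not_le.1 h2) hB
        nlinarith [mul_nonneg hA.le (hD i)]
    have h3 := Finset.sum_lt_sum_of_nonempty hne fun i _ => h1 i
    simp only [Finset.sum_const, Finset.card_univ, Fintype.card_fin, nsmul_eq_mul,
      Finset.sum_add_distrib, ← Finset.mul_sum] at h3
    have h4 := mul_le_mul_of_nonneg_left hLA hB.le
    have h5 := mul_le_mul_of_nonneg_left hDB hA.le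
    nlinarith

/-- One element of weight at least 1/2 suffices; otherwise weights below 1/2 are added until the sum
first reaches 1/2, and it stays below 1. -/
theorem exists_subset_sum_between {ι : Type*} [DecidableEq ι] (a : ι → ℝ) {b : ℝ} (hb : 1 ≤ b)
    (hab : ∀ i, a i ≤ b) (s : Finset ι) (hs : 1 / 2 ≤ ∑ i ∈ s, a i) :
    ∃ T ⊆ s, 1 / 2 ≤ ∑ i ∈ T, a i ∧ ∑ i ∈ T, a i ≤ b := by
  induction s using Finset.induction_on with
  | empty => norm_num at hs
  | insert i s hi ih =>
    by_cases h : 1 / 2 ≤ ∑ i ∈ s, a i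
    · obtain ⟨T, hT, h1, h2⟩ := ih h
      exact ⟨T, hT.trans (Finset.subset_insert _ _), h1, h2⟩
    · by_cases h' : 1 / 2 ≤ a i
      · exact ⟨{i}, by simp, by simpa using h', by simpa using hab i⟩
      · refine ⟨insert i s, subset_rfl, hs, ?_⟩
        rw [Finset.sum_insert hi]
        linarith

/-- Each family removes at most b, so after k - 1 of them 1/2 is left. -/
theorem exists_disjoint_sum_ge {ι : Type*} [DecidableEq ι] (a : ι → ℝ) {b : ℝ} (hb : 1 ≤ b)
    (hab : ∀ i, a i ≤ b) (k : ℕ) (s : Finset ι) (hs : k * b - b + 1 / 2 ≤ ∑ i ∈ s, a i) :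
    ∃ J : Fin k → Finset ι, (∀ i, J i ⊆ s) ∧ (∀ i j, i ≠ j → Disjoint (J i) (J j)) ∧
      ∀ i, 1 / 2 ≤ ∑ x ∈ J i, a x := by
  induction k generalizing s with
  | zero => exact ⟨fun i => i.elim0, fun i => i.elim0, fun i => i.elim0, fun i => i.elim0⟩
  | succ k ih =>
    push_cast at hs
    have hk : (0 : ℝ) ≤ k := k.cast_nonneg
    obtain ⟨T, hT, h1, h2⟩ := exists_subset_sum_between a hb hab s (by nlinarith)
    have h3 := Finset.sum_sdiff (f := a) hT
    obtain ⟨J, hJs, hJd, hJ⟩ := ih (s \ T) (by linarith)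
    have hTJ : ∀ i, Disjoint T (J i) := fun i =>
      Finset.disjoint_of_subset_right (hJs i) Finset.disjoint_sdiff
    refine ⟨Fin.cons T J, fun i => ?_, fun i j hij => ?_, fun i => ?_⟩
    · refine Fin.cases hT (fun i => ?_) i
      exact (hJs i).trans Finset.sdiff_subset
    · revert hij
      refine Fin.cases ?_ (fun i => ?_) i <;> refine Fin.cases ?_ (fun j => ?_) j
      · simp
      · intro _; simpa using hTJ j
      · intro _; simpa using (hTJ i).symm
      · intro hij; simpa using hJd i j (by simpa using hij)
    · refine Fin.cases ?_ (fun i => ?_) i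
      · simpa using h1
      · simpa using hJ i

end Averaging

/-! ### Inequalities for radial projection. -/

section Radial

variable {E : Type*} [NormedAddCommGroup E] [InnerProductSpace ℝ E]

/-- For y ≠ 0 the scaled sum equals (‖y‖ - ‖x‖) x/‖x‖ + (x + y), and | ‖y‖ - ‖x‖ | ≤ ‖x + y‖. A zero
vector has direction 0. -/
theorem norm_mul_norm_normalize_add_le (x y : E) :
    ‖y‖ * ‖(‖x‖⁻¹ • x) + ‖y‖⁻¹ • y‖ ≤ 2 * ‖x + y‖ := by
  rcases eq_or_ne y 0 with rfl | hy
  · simp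
  have hy' : ‖y‖ ≠ 0 := norm_ne_zero_iff.2 hy
  have h1 : ‖y‖ * ‖(‖x‖⁻¹ • x) + ‖y‖⁻¹ • y‖ = ‖(‖y‖ - ‖x‖) • (‖x‖⁻¹ • x) + (x + y)‖ := by
    rw [← Real.norm_of_nonneg (norm_nonneg y), ← norm_smul, norm_norm, smul_add, smul_smul ‖y‖ ‖y‖⁻¹,
      mul_inv_cancel₀ hy', one_smul, sub_smul]
    congr 1
    rcases eq_or_ne x 0 with rfl | hx
    · simp
    · rw [smul_smul ‖x‖, mul_inv_cancel₀ (norm_ne_zero_iff.2 hx), one_smul]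
      abel
  have h2 : ‖(‖x‖⁻¹ • x)‖ ≤ 1 := by
    rw [norm_smul, norm_inv, norm_norm]
    exact inv_mul_le_one
  have h3 : |‖y‖ - ‖x‖| ≤ ‖x + y‖ := by
    have := abs_norm_sub_norm_le y (-x)
    rwa [norm_neg, sub_neg_eq_add, add_comm y] at this
  rw [h1]
  refine (norm_add_le _ _).trans ?_
  rw [norm_smul, Real.norm_eq_abs]
  nlinarith [norm_nonneg (‖x‖⁻¹ • x), abs_nonneg (‖y‖ - ‖x‖), norm_nonneg (x + y)]

theorem norm_smul_add_smul_sq_le (a b : ℝ) (ha : |a| ≤ 1) (x y : E) :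
    ‖a • x + b • y‖ ^ 2 ≤ 2 * ‖x + y‖ ^ 2 + 2 * ((a - b) ^ 2 * ‖y‖ ^ 2) := by
  have h1 : a • x + b • y = a • (x + y) - (a - b) • y := by
    rw [smul_add, sub_smul]; abel
  have h2 : ‖a • x + b • y‖ ≤ ‖x + y‖ + |a - b| * ‖y‖ := by
    rw [h1]
    refine (norm_sub_le _ _).trans ?_
    rw [norm_smul, norm_smul, Real.norm_eq_abs, Real.norm_eq_abs]
    nlinarith [norm_nonneg (x + y)]
  have h3 : (|a - b| * ‖y‖) ^ 2 = (a - b) ^ 2 * ‖y‖ ^ 2 := by rw [mul_pow, sq_abs]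
  nlinarith [norm_nonneg (a • x + b • y), sq_nonneg (‖x + y‖ - |a - b| * ‖y‖)]

theorem inner_sq_ge_of_near {x e : E} (hx : ‖x‖ = 1) (he : ‖e‖ = 1) {r : ℝ}
    (h : ‖x - e‖ ^ 2 ≤ r ∨ ‖x + e‖ ^ 2 ≤ r) : 1 - r ≤ inner ℝ e x ^ 2 := by
  have h1 := norm_sub_sq_real x e
  have h2 := norm_add_sq_real x e
  rw [hx, he] at h1 h2
  rw [real_inner_comm]
  rcases h with h | h
  · nlinarith
  · nlinarith

end Radial

/-! ### The spectral embedding and its staircase coordinates. -/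

section Embedding

variable {V : Type*} {k : ℕ}

/-- The spectral embedding given by `k` functions. -/
noncomputable def embed (f : Fin k → V → ℝ) (u : V) : EuclideanSpace ℝ (Fin k) :=
  WithLp.toLp 2 fun j => f j u

/-- The radial projection of the spectral embedding to the unit sphere. -/
noncomputable def direction (f : Fin k → V → ℝ) (u : V) : EuclideanSpace ℝ (Fin k) :=
  ‖embed f u‖⁻¹ • embed f u

theorem norm_embed_sq (f : Fin k → V → ℝ) (u : V) : ‖embed f u‖ ^ 2 = ∑ j, f j u ^ 2 := by
  rw [EuclideanSpace.real_norm_sq_eq]; rfl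

theorem norm_direction {f : Fin k → V → ℝ} {u : V} (h : embed f u ≠ 0) : ‖direction f u‖ = 1 := by
  rw [direction, norm_smul, norm_inv, norm_norm, inv_mul_cancel₀ (norm_ne_zero_iff.2 h)]

theorem norm_smul_direction (f : Fin k → V → ℝ) (u : V) :
    ‖embed f u‖ • direction f u = embed f u := by
  rcases eq_or_ne (embed f u) 0 with h | h
  · rw [h, norm_zero, zero_smul]
  · rw [direction, smul_smul, mul_inv_cancel₀ (norm_ne_zero_iff.2 h), one_smul]

theorem norm_smul_embed_add_sq (f : Fin k → V → ℝ) (θ : V → ℝ) (u v : V) :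
    ‖θ u • embed f u + θ v • embed f v‖ ^ 2 = ∑ j, (θ u * f j u + θ v * f j v) ^ 2 := by
  rw [EuclideanSpace.real_norm_sq_eq]; rfl

/-- The staircase coordinates of a vertex. -/
noncomputable def stairCoord (f : Fin k → V → ℝ) (n : ℕ) (c : ℝ) (i : ℕ) (u : V) : Fin k → ℝ :=
  fun j => oddStair n i (c * direction f u j)

/-- The 3 is 1 for the cell plus 1 for each of the two staircases' deviations from s/n. -/
theorem direction_near_of_cellKey_eq {f : Fin k → V → ℝ} {n : ℕ} (hn : 0 < n) {c : ℝ}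
    (hc : 0 < c) {i : ℕ} {u v : V}
    (h : cellKey (stairCoord f n c i u) = cellKey (stairCoord f n c i v)) :
    ‖direction f u - direction f v‖ ^ 2 ≤ k * (3 * n / c) ^ 2 ∨
      ‖direction f u + direction f v‖ ^ 2 ≤ k * (3 * n / c) ^ 2 := by
  have hn' : (0 : ℝ) < n := by exact_mod_cast hn
  have key : ∀ z : EuclideanSpace ℝ (Fin k), (∀ j, |c * z j / n| ≤ 3) →
      ‖z‖ ^ 2 ≤ k * (3 * n / c) ^ 2 := by
    intro z hz
    rw [EuclideanSpace.real_norm_sq_eq]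
    have h1 : ∀ j, z j ^ 2 ≤ (3 * n / c) ^ 2 := fun j => by
      rw [← sq_abs]
      refine pow_le_pow_left₀ (abs_nonneg _) ?_ 2
      have := hz j
      rw [abs_div, abs_mul, abs_of_pos hc, abs_of_pos hn', div_le_iff₀ hn'] at this
      rw [le_div_iff₀ hc]
      linarith
    refine (Finset.sum_le_sum fun j _ => h1 j).trans (le_of_eq ?_)
    rw [Finset.sum_const, Finset.card_univ, Fintype.card_fin, nsmul_eq_mul]
  refine (cellKey_eq h).imp (fun h => key _ fun j => ?_) (fun h => key _ fun j => ?_)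
  · have h1 := abs_le.1 (h j)
    have h2 := abs_le.1 (abs_oddStair_sub_le n i (c * direction f u j))
    have h3 := abs_le.1 (abs_oddStair_sub_le n i (c * direction f v j))
    simp only [stairCoord] at h1
    have h4 : c * (direction f u - direction f v) j / n
        = c * direction f u j / n - c * direction f v j / n := by
      rw [PiLp.sub_apply]; ring
    rw [h4, abs_le]
    constructor <;> linarith
  · have h1 := abs_le.1 (h j)
    have h2 := abs_le.1 (abs_oddStair_sub_le n i (c * direction f u j))
    have h3 := abs_le.1 (abs_oddStair_sub_le n i (c * direction f v j))
    simp only [stairCoord] at h1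
    have h4 : c * (direction f u + direction f v) j / n
        = c * direction f u j / n + c * direction f v j / n := by
      rw [PiLp.add_apply]; ring
    rw [h4, abs_le]
    constructor <;> linarith

end Embedding

/-! ### Mass, loss and stretch of the localized embedding. -/

section Localization

variable {V : Type*} [Fintype V] (G : WeightedGraph V) {k : ℕ}

theorem sum_signlessEnergy_mul (f : Fin k → V → ℝ) (θ : V → ℝ) :
    ∑ j, G.signlessEnergy (fun u => θ u * f j u)
      = 1 / 2 * ∑ u, ∑ v, G.w u v * ‖θ u • embed f u + θ v • embed f v‖ ^ 2 := by
  unfold signlessEnergy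
  rw [← Finset.mul_sum, Finset.sum_comm]
  congr 1
  refine Finset.sum_congr rfl fun u _ => ?_
  rw [Finset.sum_comm]
  exact Finset.sum_congr rfl fun v _ => by rw [norm_smul_embed_add_sq, Finset.mul_sum]

theorem sum_sqNorm_mul (f : Fin k → V → ℝ) (θ : V → ℝ) :
    ∑ j, G.sqNorm (fun u => θ u * f j u) = ∑ u, G.deg u * (θ u ^ 2 * ‖embed f u‖ ^ 2) := by
  unfold sqNorm
  rw [Finset.sum_comm]
  refine Finset.sum_congr rfl fun u _ => ?_
  rw [norm_embed_sq, Finset.mul_sum, Finset.mul_sum]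
  exact Finset.sum_congr rfl fun j _ => by ring

theorem sum_deg_mul_norm_embed_sq {f : Fin k → V → ℝ}
    (hf : ∀ i j, ∑ u, G.deg u * f i u * f j u = if i = j then 1 else 0) :
    ∑ u, G.deg u * ‖embed f u‖ ^ 2 = k := by
  simp only [norm_embed_sq, Finset.mul_sum]
  rw [Finset.sum_comm]
  have h : ∀ j, ∑ u, G.deg u * f j u ^ 2 = 1 := fun j => by
    have := hf j j
    rw [if_pos rfl] at this
    rw [← this]
    exact Finset.sum_congr rfl fun u _ => by ring
  simp [h]

/-- Isotropy of the embedding: no direction carries more than mass 1 out of k. -/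
theorem sum_deg_mul_inner_embed_sq {f : Fin k → V → ℝ}
    (hf : ∀ i j, ∑ u, G.deg u * f i u * f j u = if i = j then 1 else 0)
    (e : EuclideanSpace ℝ (Fin k)) :
    ∑ u, G.deg u * inner ℝ e (embed f u) ^ 2 = ‖e‖ ^ 2 := by
  have h1 : ∀ u, G.deg u * inner ℝ e (embed f u) ^ 2
      = ∑ i, ∑ j, e i * e j * (G.deg u * f i u * f j u) := by
    intro u
    have h2 : inner ℝ e (embed f u) = ∑ i, e i * f i u := by
      rw [PiLp.inner_apply]
      exact Finset.sum_congr rfl fun i _ => by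
        simp [embed, mul_comm]
    rw [h2, sq, Finset.sum_mul_sum, Finset.mul_sum]
    refine Finset.sum_congr rfl fun i _ => ?_
    rw [Finset.mul_sum]
    exact Finset.sum_congr rfl fun j _ => by ring
  simp only [h1]
  rw [Finset.sum_comm]
  rw [EuclideanSpace.real_norm_sq_eq]
  refine Finset.sum_congr rfl fun i _ => ?_
  rw [Finset.sum_comm]
  simp only [← Finset.mul_sum, hf]
  simp [sq]

/-- The mass of a set of directions of small projective diameter is at most about `1`. -/
theorem sum_mass_le_of_near {f : Fin k → V → ℝ}
    (hf : ∀ i j, ∑ u, G.deg u * f i u * f j u = if i = j then 1 else 0) {r : ℝ}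
    (hr1 : r < 1) (K : Finset V)
    (hK : ∀ u ∈ K, ∀ v ∈ K, ‖direction f u - direction f v‖ ^ 2 ≤ r ∨
      ‖direction f u + direction f v‖ ^ 2 ≤ r) :
    ∑ u ∈ K, G.deg u * ‖embed f u‖ ^ 2 ≤ 1 / (1 - r) := by
  by_cases h0 : ∃ v ∈ K, embed f v ≠ 0
  · obtain ⟨v, hv, hv0⟩ := h0
    have h1 := G.sum_deg_mul_inner_embed_sq hf (direction f v)
    rw [norm_direction hv0, one_pow] at h1
    rw [le_div_iff₀ (by linarith), Finset.sum_mul]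
    refine le_trans ?_ h1.le
    refine (Finset.sum_le_sum fun u hu => ?_).trans (Finset.sum_le_univ_sum_of_nonneg fun u =>
      mul_nonneg (G.deg_pos u).le (sq_nonneg _))
    rw [mul_assoc]
    refine mul_le_mul_of_nonneg_left ?_ (G.deg_pos u).le
    by_cases hu0 : embed f u = 0
    · simp [hu0]
    · have h2 := inner_sq_ge_of_near (norm_direction hu0) (norm_direction hv0)
        (hK u hu v hv)
      rw [← norm_smul_direction f u, real_inner_smul_right, norm_smul, norm_norm,
        norm_direction hu0, mul_one, mul_pow]
      exact mul_le_mul_of_nonneg_left h2 (sq_nonneg _)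
  · push Not at h0
    rw [Finset.sum_eq_zero fun u hu => by rw [h0 u hu]; simp]
    exact (div_pos one_pos (by linarith)).le

theorem sum_loss_le (f : Fin k → V → ℝ) (n : ℕ) (c : ℝ) :
    ∑ i : Fin n, ∑ u, G.deg u * ‖embed f u‖ ^ 2 *
      ∑ j, |stairCoord f n c i u j - round (stairCoord f n c i u j)|
      ≤ k * ∑ u, G.deg u * ‖embed f u‖ ^ 2 := by
  rw [Finset.sum_comm, Finset.mul_sum]
  refine Finset.sum_le_sum fun u _ => ?_
  rw [← Finset.mul_sum, mul_comm (k : ℝ)]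
  refine mul_le_mul_of_nonneg_left ?_ (mul_nonneg (G.deg_pos u).le (sq_nonneg _))
  rw [Finset.sum_comm]
  refine (Finset.sum_le_sum fun j _ => sum_abs_oddStair_sub_round_le n _).trans (le_of_eq ?_)
  simp

/-- The total over i does not grow with n, so a typical i stretches the edges only by order c²/n,
although cells have diameter of order n/c per coordinate. -/
theorem sum_stretch_le (f : Fin k → V → ℝ) {n : ℕ} (hn : 0 < n) (c : ℝ) :
    ∑ i : Fin n, ∑ u, ∑ v, G.w u v * (‖embed f v‖ ^ 2 *
      ∑ j, (stairCoord f n c i u j + stairCoord f n c i v j) ^ 2)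
      ≤ 8 * c ^ 2 * ∑ j, G.signlessEnergy (f j) := by
  have h0 : ∑ j, G.signlessEnergy (f j)
      = 1 / 2 * ∑ u, ∑ v, G.w u v * ‖embed f u + embed f v‖ ^ 2 := by
    simpa using G.sum_signlessEnergy_mul f (fun _ => 1)
  have h1 : 8 * c ^ 2 * (1 / 2 * ∑ u, ∑ v, G.w u v * ‖embed f u + embed f v‖ ^ 2)
      = 4 * c ^ 2 * ∑ u, ∑ v, G.w u v * ‖embed f u + embed f v‖ ^ 2 := by ring
  rw [h0, h1, Finset.sum_comm, Finset.mul_sum]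
  refine Finset.sum_le_sum fun u _ => ?_
  rw [Finset.sum_comm, Finset.mul_sum]
  refine Finset.sum_le_sum fun v _ => ?_
  rw [← Finset.mul_sum, ← Finset.mul_sum, mul_left_comm (4 * c ^ 2)]
  refine mul_le_mul_of_nonneg_left ?_ (G.w_nonneg u v)
  have h2 : ∑ i : Fin n, ∑ j, (stairCoord f n c i u j + stairCoord f n c i v j) ^ 2
      ≤ c ^ 2 * ‖direction f u + direction f v‖ ^ 2 := by
    rw [Finset.sum_comm, EuclideanSpace.real_norm_sq_eq, Finset.mul_sum]
    refine Finset.sum_le_sum fun j _ => (sum_sq_oddStair_add_le hn _ _).trans (le_of_eq ?_)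
    rw [PiLp.add_apply]; ring
  have h3 : ‖embed f v‖ * ‖direction f u + direction f v‖ ≤ 2 * ‖embed f u + embed f v‖ :=
    norm_mul_norm_normalize_add_le _ _
  have h4 := pow_le_pow_left₀ (by positivity) h3 2
  calc _ ≤ ‖embed f v‖ ^ 2 * (c ^ 2 * ‖direction f u + direction f v‖ ^ 2) :=
        mul_le_mul_of_nonneg_left h2 (sq_nonneg _)
    _ = c ^ 2 * (‖embed f v‖ * ‖direction f u + direction f v‖) ^ 2 := by ring
    _ ≤ c ^ 2 * (2 * ‖embed f u + embed f v‖) ^ 2 := mul_le_mul_of_nonneg_left h4 (sq_nonneg _)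
    _ = _ := by ring

/-- A Leibniz rule: the energy of the map plus the variation of the cut-off weighted by the squared
norm of the map. -/
theorem sum_signlessEnergy_cellBump_le (f : Fin k → V → ℝ) (p : V → Fin k → ℝ)
    (J : Finset (Sym2 (Fin k → ℤ))) :
    ∑ j, G.signlessEnergy (fun u => cellBump J (p u) * f j u)
      ≤ 2 * ∑ j, G.signlessEnergy (f j)
        + 4 * ∑ u, ∑ v, G.w u v * (‖embed f v‖ ^ 2 * ∑ j, (p u j + p v j) ^ 2) := by
  have h0 : ∑ j, G.signlessEnergy (f j)
      = 1 / 2 * ∑ u, ∑ v, G.w u v * ‖embed f u + embed f v‖ ^ 2 := by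
    simpa using G.sum_signlessEnergy_mul f (fun _ => 1)
  have habs : ∀ q : Fin k → ℝ, |cellBump J q| ≤ 1 := fun q => by
    unfold cellBump
    split_ifs
    · rw [abs_of_nonneg (bump_nonneg q)]; exact bump_le_one q
    · simp
  have h1 : ∑ u, ∑ v, G.w u v *
        ‖cellBump J (p u) • embed f u + cellBump J (p v) • embed f v‖ ^ 2
      ≤ ∑ u, ∑ v, (2 * (G.w u v * ‖embed f u + embed f v‖ ^ 2)
        + 8 * (G.w u v * (‖embed f v‖ ^ 2 * ∑ j, (p u j + p v j) ^ 2))) := by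
    refine Finset.sum_le_sum fun u _ => Finset.sum_le_sum fun v _ => ?_
    have h2 := norm_smul_add_smul_sq_le (cellBump J (p u)) (cellBump J (p v)) (habs _)
      (embed f u) (embed f v)
    have h3 := mul_le_mul_of_nonneg_right (sq_cellBump_sub_le J (p u) (p v))
      (sq_nonneg ‖embed f v‖)
    have h4 : ‖cellBump J (p u) • embed f u + cellBump J (p v) • embed f v‖ ^ 2
        ≤ 2 * ‖embed f u + embed f v‖ ^ 2
          + 8 * (‖embed f v‖ ^ 2 * ∑ j, (p u j + p v j) ^ 2) := by linarith
    refine (mul_le_mul_of_nonneg_left h4 (G.w_nonneg u v)).trans (le_of_eq (by ring))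
  simp only [Finset.sum_add_distrib, ← Finset.mul_sum] at h1
  rw [G.sum_signlessEnergy_mul f (fun u => cellBump J (p u)), h0]
  linarith

end Localization

/-! ### Choice of parameters and assembly. -/

section Main

variable {V : Type*} [Fintype V] (G : WeightedGraph V)

/-- Some coordinate of nonzero norm does no worse than the quotient of the sums; coordinates of norm
0 only add energy. -/
theorem exists_signlessEnergy_le_of_sum {k : ℕ} (g : Fin k → V → ℝ) {ρ e m : ℝ}
    (hm : 0 < m) (hsum : m ≤ ∑ j, G.sqNorm (g j)) (hE : ∑ j, G.signlessEnergy (g j) ≤ e)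
    (hρ : 0 ≤ ρ) (he : e ≤ ρ * m) :
    ∃ j, 0 < G.sqNorm (g j) ∧ G.signlessEnergy (g j) ≤ ρ * G.sqNorm (g j) := by
  by_contra! h
  obtain ⟨j, -, hj⟩ : ∃ j ∈ Finset.univ, 0 < G.sqNorm (g j) := by
    by_contra! h'
    linarith [Finset.sum_nonpos h']
  have h1 : ∑ j, ρ * G.sqNorm (g j) < ∑ j, G.signlessEnergy (g j) := by
    refine Finset.sum_lt_sum (fun i _ => ?_) ⟨j, Finset.mem_univ j, h j hj⟩
    rcases (G.sqNorm_nonneg (g i)).eq_or_lt with h2 | h2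
    · rw [← h2, mul_zero]; exact G.signlessEnergy_nonneg _
    · exact (h i h2).le
  rw [← Finset.mul_sum] at h1
  nlinarith

/-- There are staircase coordinates whose cells carry almost all of the mass of the embedding and
which stretch the edges only moderately. -/
theorem exists_stairCoord {k : ℕ} (hk : 1 ≤ k) {f : Fin k → V → ℝ}
    (hf : ∀ i j, ∑ u, G.deg u * f i u * f j u = if i = j then 1 else 0) {δ : ℝ}
    (hδ : ∀ i, G.signlessEnergy (f i) ≤ δ) :
    ∃ i, (k : ℝ) - 1 / 4 ≤
        ∑ u, G.deg u * (bump (stairCoord f (32 * k ^ 2) (256 * k ^ 3) i u) ^ 2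
          * ‖embed f u‖ ^ 2) ∧
      ∑ u, ∑ v, G.w u v * (‖embed f v‖ ^ 2 *
        ∑ j, (stairCoord f (32 * k ^ 2) (256 * k ^ 3) i u j
          + stairCoord f (32 * k ^ 2) (256 * k ^ 3) i v j) ^ 2) ≤ 32768 * k ^ 5 * δ := by
  have hk0 : (0 : ℝ) < k := by exact_mod_cast hk
  have hn : 0 < 32 * k ^ 2 := by positivity
  -- The choice n = 32k² makes the average loss k²/n = 1/32, and n/c = 1/(8k) makes the cells small
  -- enough for mass 1 + 1/(4k). The stretch bound is 8c² · kδ/n = 16384k⁵δ; both averages are then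
  -- doubled.
  set c : ℝ := 256 * k ^ 3 with hc
  have hmass := G.sum_deg_mul_norm_embed_sq hf
  have hE : ∑ j, G.signlessEnergy (f j) ≤ k * δ := by
    refine (Finset.sum_le_sum fun j _ => hδ j).trans (le_of_eq ?_)
    simp
  obtain ⟨i, hL, hD⟩ := exists_le_two_mul_average hn
    (fun i => ∑ u, G.deg u * ‖embed f u‖ ^ 2 * ∑ j, |stairCoord f (32 * k ^ 2) c i u j
      - round (stairCoord f (32 * k ^ 2) c i u j)|)
    (fun i => ∑ u, ∑ v, G.w u v * (‖embed f v‖ ^ 2 *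
      ∑ j, (stairCoord f (32 * k ^ 2) c i u j + stairCoord f (32 * k ^ 2) c i v j) ^ 2))
    (fun i => Finset.sum_nonneg fun u _ => Finset.sum_nonneg fun v _ =>
      mul_nonneg (G.w_nonneg u v) (mul_nonneg (sq_nonneg _)
        (Finset.sum_nonneg fun j _ => sq_nonneg _)))
    (A := 1 / 32) (B := 16384 * k ^ 5 * δ) (by norm_num)
    (fun i => Finset.sum_nonneg fun u _ =>
      mul_nonneg (mul_nonneg (G.deg_pos u).le (sq_nonneg _))
        (Finset.sum_nonneg fun j _ => abs_nonneg _))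
    (by
      refine (G.sum_loss_le f _ c).trans (le_of_eq ?_)
      rw [hmass]; push_cast; ring)
    (by
      refine (G.sum_stretch_le f hn c).trans ?_
      refine (mul_le_mul_of_nonneg_left hE (by positivity)).trans (le_of_eq ?_)
      rw [hc]; push_cast; ring)
  refine ⟨i, ?_, hD.trans (le_of_eq (by ring))⟩
  have h1 : ∀ u, G.deg u * ‖embed f u‖ ^ 2 - 4 * (G.deg u * ‖embed f u‖ ^ 2 *
      ∑ j, |stairCoord f (32 * k ^ 2) c i u j - round (stairCoord f (32 * k ^ 2) c i u j)|)
      ≤ G.deg u * (bump (stairCoord f (32 * k ^ 2) c i u) ^ 2 * ‖embed f u‖ ^ 2) := fun u => by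
    have h2 := mul_le_mul_of_nonneg_left (one_sub_bump_sq_le (stairCoord f (32 * k ^ 2) c i u))
      (mul_nonneg (G.deg_pos u).le (sq_nonneg ‖embed f u‖))
    linarith
  have h2 := Finset.sum_le_sum fun u (_ : u ∈ Finset.univ) => h1 u
  rw [Finset.sum_sub_distrib, ← Finset.mul_sum, hmass] at h2
  linarith

theorem sum_mass_cell_le {k : ℕ} (hk : 1 ≤ k) {f : Fin k → V → ℝ}
    (hf : ∀ i j, ∑ u, G.deg u * f i u * f j u = if i = j then 1 else 0) (i : ℕ) (K : Finset V)
    (hK : ∀ u ∈ K, ∀ v ∈ K, cellKey (stairCoord f (32 * k ^ 2) (256 * k ^ 3) i u)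
      = cellKey (stairCoord f (32 * k ^ 2) (256 * k ^ 3) i v)) :
    ∑ u ∈ K, G.deg u * (bump (stairCoord f (32 * k ^ 2) (256 * k ^ 3) i u) ^ 2 *
      ‖embed f u‖ ^ 2) ≤ 1 + 1 / (4 * k) := by
  have hk0 : (0 : ℝ) < k := by exact_mod_cast hk
  have hk1 : (1 : ℝ) ≤ k := by exact_mod_cast hk
  have hr : (k : ℝ) * (3 * (32 * k ^ 2 : ℕ) / (256 * k ^ 3)) ^ 2 = 9 / (64 * k) := by
    push_cast; field_simp; norm_num
  have hr1 : 9 / (64 * (k : ℝ)) < 1 := by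
    rw [div_lt_one (by positivity)]; linarith
  have h1 := G.sum_mass_le_of_near hf hr1 K fun u hu v hv => by
    have := direction_near_of_cellKey_eq (by positivity) (by positivity) (hK u hu v hv)
    rwa [hr] at this
  refine le_trans (Finset.sum_le_sum fun u _ => ?_) (h1.trans ?_)
  · refine mul_le_mul_of_nonneg_left ?_ (G.deg_pos u).le
    refine mul_le_of_le_one_left (sq_nonneg _) ?_
    exact pow_le_one₀ (bump_nonneg _) (bump_le_one _)
  · rw [div_le_iff₀ (by linarith)]
    have h2 : (1 + 1 / (4 * (k : ℝ))) * (1 - 9 / (64 * k)) = 1 + (28 * k - 9) / (256 * k ^ 2) := by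
      field_simp; ring
    rw [h2]
    have : 0 ≤ (28 * (k : ℝ) - 9) / (256 * k ^ 2) := div_nonneg (by linarith) (by positivity)
    linarith

/-- Localization: `k` disjointly supported functions whose Rayleigh quotients for the signless
Laplacian are at most a polynomial in `k` times the spectral gap. -/
theorem exists_disjoint_signlessEnergy_le {k : ℕ} (hk : 1 ≤ k) (hkN : k ≤ Fintype.card V) :
    ∃ g : Fin k → V → ℝ, (∀ i j, i ≠ j → ∀ u, g i u = 0 ∨ g j u = 0) ∧
      ∀ i, 0 < G.sqNorm (g i) ∧
        G.signlessEnergy (g i) ≤ 262148 * k ^ 5 * G.topGap k * G.sqNorm (g i) := by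
  classical
  have hk0 : (0 : ℝ) < k := by exact_mod_cast hk
  have hk1 : (1 : ℝ) ≤ k := by exact_mod_cast hk
  have hδ := G.topGap_nonneg hk hkN
  obtain ⟨f, hf, hfE⟩ := G.exists_orthonormal_signlessEnergy_le hk hkN
  obtain ⟨i, hmass, hstretch⟩ := G.exists_stairCoord hk hf hfE
  set p := stairCoord f (32 * k ^ 2) (256 * k ^ 3) i with hp
  let mass : Sym2 (Fin k → ℤ) → ℝ := fun κ =>
    ∑ u ∈ Finset.univ.filter (fun u => cellKey (p u) = κ),
      G.deg u * (bump (p u) ^ 2 * ‖embed f u‖ ^ 2)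
  have hmle : ∀ κ, mass κ ≤ 1 + 1 / (4 * k) := fun κ =>
    G.sum_mass_cell_le hk hf i _ fun u hu v hv =>
      (Finset.mem_filter.1 hu).2.trans (Finset.mem_filter.1 hv).2.symm
  have htot : ∑ κ ∈ Finset.univ.image (fun u => cellKey (p u)), mass κ
      = ∑ u, G.deg u * (bump (p u) ^ 2 * ‖embed f u‖ ^ 2) :=
    Finset.sum_fiberwise_of_maps_to (fun u hu => Finset.mem_image_of_mem _ hu) _
  -- With b = 1 + 1/(4k), the required total kb - b + 1/2 = k - 1/4 - 1/(4k) is below the available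
  -- k - 1/4.
  obtain ⟨J, -, hJd, hJ⟩ := exists_disjoint_sum_ge mass
    (b := 1 + 1 / (4 * k)) (by have : 0 ≤ 1 / (4 * (k : ℝ)) := by positivity
                               linarith) hmle k
    (Finset.univ.image (fun u => cellKey (p u))) (by
      rw [htot]
      refine le_trans ?_ hmass
      have h1 : (k : ℝ) * (1 + 1 / (4 * k)) = k + 1 / 4 := by field_simp
      have h2 : 0 ≤ 1 / (4 * (k : ℝ)) := by positivity
      rw [h1]
      linarith)
  have hJmass : ∀ i, 1 / 2 ≤ ∑ j, G.sqNorm (fun u => cellBump (J i) (p u) * f j u) := by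
    intro i
    refine (hJ i).trans (le_of_eq ?_)
    rw [G.sum_sqNorm_mul f (fun u => cellBump (J i) (p u))]
    simp only [mass, Finset.sum_filter]
    rw [Finset.sum_comm]
    refine Finset.sum_congr rfl fun u _ => ?_
    rw [Finset.sum_ite_eq, cellBump]
    split_ifs <;> simp
  have hE : ∑ j, G.signlessEnergy (f j) ≤ k * G.topGap k := by
    refine (Finset.sum_le_sum fun j _ => hfE j).trans (le_of_eq ?_)
    simp
  have hJE : ∀ i, ∑ j, G.signlessEnergy (fun u => cellBump (J i) (p u) * f j u)
      ≤ 131074 * k ^ 5 * G.topGap k := by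
    intro i
    refine (G.sum_signlessEnergy_cellBump_le f p (J i)).trans ?_
    have h1 : (k : ℝ) * G.topGap k ≤ k ^ 5 * G.topGap k :=
      mul_le_mul_of_nonneg_right (le_self_pow₀ hk1 (by norm_num)) hδ
    linarith
  -- Energy 131074 = 2 + 4 · 32768 over mass 1/2 gives 262148.
  choose j hj using fun i => G.exists_signlessEnergy_le_of_sum
    (fun j u => cellBump (J i) (p u) * f j u) (ρ := 262148 * k ^ 5 * G.topGap k) one_half_pos
    (hJmass i) (hJE i) (by positivity) (le_of_eq (by ring))
  refine ⟨fun i u => cellBump (J i) (p u) * f (j i) u, fun i i' hii u => ?_, hj⟩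
  by_cases h : cellKey (p u) ∈ J i
  · right
    have h' : cellKey (p u) ∉ J i' := Finset.disjoint_left.1 (hJd i i' hii) h
    simp [cellBump, h']
  · left
    simp [cellBump, h]

variable [DecidableEq V]

theorem one_sub_dualCheeger_le {k : ℕ} (hk : 1 ≤ k) {g : Fin k → V → ℝ}
    (hd : ∀ i j, i ≠ j → ∀ u, g i u = 0 ∨ g j u = 0) {ρ : ℝ}
    (hg : ∀ i, ∃ S T : Finset V, (∀ u ∈ S, 0 < g i u) ∧ (∀ u ∈ T, g i u < 0) ∧ S ∪ T ≠ ∅ ∧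
      1 - G.dualExpansion S T ≤ ρ) : 1 - G.dualCheeger k ≤ ρ := by
  choose S T hS hT hne hle using hg
  let P : Fin k × Fin 2 → Finset V := fun p => if p.2 = 0 then S p.1 else T p.1
  have hP : ∀ p, ∀ u ∈ P p, g p.1 u ≠ 0 := by
    rintro ⟨i, a⟩ u hu
    by_cases ha : a = 0
    · simp only [P, ha, if_true] at hu
      exact (hS i u hu).ne'
    · simp only [P, ha, if_false] at hu
      exact (hT i u hu).ne
  have hsub : IsSubBipartition P := by
    refine ⟨fun p q hpq => ?_, fun i => by simpa [P] using hne i⟩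
    rw [← Finset.disjoint_iff_inter_eq_empty, Finset.disjoint_left]
    intro u hp hq
    by_cases h : p.1 = q.1
    · obtain ⟨i, a⟩ := p
      obtain ⟨i', b⟩ := q
      obtain rfl : i = i' := h
      have hST : ∀ u, u ∈ S i → u ∈ T i → False := fun u h1 h2 => by
        linarith [hS i u h1, hT i u h2]
      fin_cases a <;> fin_cases b <;> simp [P] at hpq hp hq
      · exact hST u hp hq
      · exact hST u hq hp
    · exact (hd p.1 q.1 h u).elim (hP p u hp) (hP q u hq)
  have : Nonempty (Fin k) := ⟨⟨0, hk⟩⟩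
  have h1 : ⨅ i : Fin k, G.dualExpansion (P (i, 0)) (P (i, 1)) ≤ G.dualCheeger k :=
    le_ciSup (f := fun P : {P : Fin k × Fin 2 → Finset V // IsSubBipartition P} =>
      ⨅ i : Fin k, G.dualExpansion (P.1 (i, 0)) (P.1 (i, 1))) (Set.finite_range _).bddAbove
      ⟨P, hsub⟩
  have h2 : 1 - ρ ≤ ⨅ i : Fin k, G.dualExpansion (P (i, 0)) (P (i, 1)) :=
    le_ciInf fun i => by
      have := hle i
      simp only [P]
      simp only [if_true, one_ne_zero, if_false]
      linarith
  linarith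

end Main

end WeightedGraph

theorem mainTheorem9 :
    ∃ C : ℝ, 0 < C ∧
      ∀ (V : Type*) [Fintype V] [DecidableEq V] (G : WeightedGraph V) (k l : ℕ),
        1 ≤ k → k ≤ l → l ≤ Fintype.card V →
          1 - G.dualCheeger k ≤
            C * l * (k : ℝ) ^ 6 *
              ((2 - G.eigenvalue (Fintype.card V - k + 1)) /
                √(2 - G.eigenvalue (Fintype.card V - l + 1))) := by
  refine ⟨144 * 262148, by norm_num, fun V _ _ G k l hk hkl hlN => ?_⟩
  obtain ⟨g, hd, hg⟩ := G.exists_disjoint_signlessEnergy_le hk (hkl.trans hlN)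
  have hl := hk.trans hkl
  change _ ≤ 144 * 262148 * l * (k : ℝ) ^ 6 * (G.topGap k / √(G.topGap l))
  have hk1 : (1 : ℝ) ≤ k := by exact_mod_cast hk
  have hδk := G.topGap_nonneg hk (hkl.trans hlN)
  -- If `topGap l` = 0 then `topGap k` = 0 by monotonicity, the quotient is 0, and every g has zero
  -- energy.
  rcases (G.topGap_nonneg hl hlN).eq_or_lt with hδ | hδ
  · have hk0 : G.topGap k = 0 := le_antisymm (hδ ▸ G.topGap_mono hk hkl hlN) hδk
    rw [hk0, zero_div, mul_zero]
    refine G.one_sub_dualCheeger_le hk hd fun i => ?_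
    refine G.exists_dualExpansion_eq_one (g i) (fun h => ?_) (le_antisymm ?_
      (G.signlessEnergy_nonneg _))
    · have := (hg i).1
      simp [h, WeightedGraph.sqNorm] at this
    · have := (hg i).2
      rwa [hk0, mul_zero, zero_mul] at this
  · refine G.one_sub_dualCheeger_le hk hd fun i => ?_
    obtain ⟨S, T, hS, hT, hne, hle⟩ :=
      G.exists_dualExpansion_of_signlessEnergy hl hlN hδ (g i) (hg i).1
    refine ⟨S, T, hS, hT, hne, hle.trans ?_⟩
    have h1 : G.signlessEnergy (g i) / G.sqNorm (g i) ≤ 262148 * k ^ 6 * G.topGap k := by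
      rw [div_le_iff₀ (hg i).1]
      refine (hg i).2.trans ?_
      -- The localization already gives k⁵; one power of k is given away.
      have : (k : ℝ) ^ 5 ≤ k ^ 6 := pow_le_pow_right₀ hk1 (by norm_num)
      have hn := (hg i).1.le
      gcongr
    calc 144 * l * (G.signlessEnergy (g i) / G.sqNorm (g i) / √(G.topGap l))
        ≤ 144 * l * (262148 * k ^ 6 * G.topGap k / √(G.topGap l)) := by gcongr
      _ = _ := by ring
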